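/- Let $n\ge 1$ and let $J:\mathbb R^n\to\mathbb R$ be a continuous nonnegative function which is spherically symmetric and radially decreasing ($|x|\le |y|$ implies $J(x)\ge J(y)$), with $J(0)>0$ and $\int_{\mathbb R^n}J(x)\,dx=1$. Let $\Omega\subset\mathbb R^n$ be a bounded open set, $a_\Omega:\overline\Omega\to[0,\infty)$ a continuous function, and $\Omega^*$ the open ball centred at the origin with $|\Omega^*|=|\Omega|$. Let $c_n$ be the measure of the unit ball of $\mathbb R^n$, and define $$\mu(t)=|\{x\in\Omega: |a_\Omega(x)|>t\}|\ (t\ge 0),\qquad a^{\#}(s)=|\{t\ge 0:\mu(t)>s\}|,\qquad a_{*}(x)=a^{\#}\big(|\Omega|-c_n|x|^n\big)\quad (x\in\Omega^*),$$ so that $a_*$ is the symmetric increasing rearrangement of $a_\Omega$. Consider the bounded self-adjoint operators $$\mathcal B_\Omega u(x)=a_\Omega(x)u(x)-\int_\Omega J(x-y)u(y)\,dy\quad\text{on }L^2(\Omega),$$ $$\mathcal B^*_{\Omega^*}u(x)=a_*(x)u(x)-\int_{\Omega^*}J(x-y)u(y)\,dy\quad\text{on }L^2(\Omega^*),$$ where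 the $L^2$ spaces are either both real or both complex. The first eigenvalue of such an operator, if it exists, is an eigenvalue which is the minimum of (the real part of) its spectrum. If $\mathcal B_\Omega$ and $\mathcal B^*_{\Omega^*}$ have first eigenvalues $\lambda_1(\Omega)$ and $\lambda_1^*(\Omega^*)$, then $$\lambda_1(\Omega)\ \ge\ \lambda_1^*(\Omega^*).$$ -/

import Mathlib

open MeasureTheory Set
open scoped ENNReal

noncomputable section

/-- The conditions on the kernel: `J` is a continuous nonnegative function on `ℝⁿ`, spherically
symmetric and radially decreasing (in the non-strict sense), with `J 0 > 0` and total mass `1`.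
(A nonzero Bochner integral forces `J` to be integrable.) -/
structure KernelH {n : ℕ} (J : EuclideanSpace ℝ (Fin n) → ℝ) : Prop where
  continuous : Continuous J
  nonneg : ∀ x, 0 ≤ J x
  radial : ∀ x y, ‖x‖ = ‖y‖ → J x = J y
  decreasing : ∀ x y, ‖x‖ ≤ ‖y‖ → J y ≤ J x
  pos_zero : 0 < J 0
  integral_eq_one : ∫ x, J x = 1

/-! ### Rearrangements -/

/-- The distribution function `μ(t) = |{x ∈ Ω : |u x| > t}|`. -/
def distribFun {n : ℕ} (Ω : Set (EuclideanSpace ℝ (Fin n))) (u : EuclideanSpace ℝ (Fin n) → ℝ)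
    (t : ℝ) : ℝ :=
  volume.real {x | x ∈ Ω ∧ t < |u x|}

/-- The decreasing rearrangement `u^#`, i.e. the distribution function of `distribFun Ω u`
(as a function on `[0, ∞)`): `u^#(s) = |{t ≥ 0 : μ(t) > s}|`. -/
def decRearr {n : ℕ} (Ω : Set (EuclideanSpace ℝ (Fin n))) (u : EuclideanSpace ℝ (Fin n) → ℝ)
    (s : ℝ) : ℝ :=
  (volume {t : ℝ | 0 ≤ t ∧ s < distribFun Ω u t}).toReal

/-- The increasing rearrangement `u_#(s) = u^#(|Ω| - s)`. -/
def incRearr {n : ℕ} (Ω : Set (EuclideanSpace ℝ (Fin n))) (u : EuclideanSpace ℝ (Fin n) → ℝ)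
    (s : ℝ) : ℝ :=
  decRearr Ω u (volume.real Ω - s)

/-- The measure `c_n` of the unit ball of `ℝⁿ`. -/
def unitBallVol (n : ℕ) : ℝ :=
  volume.real (Metric.ball (0 : EuclideanSpace ℝ (Fin n)) 1)

/-- The symmetric increasing rearrangement `u_*(x) = u_#(c_n |x|ⁿ)`. -/
def symmIncRearr {n : ℕ} (Ω : Set (EuclideanSpace ℝ (Fin n))) (u : EuclideanSpace ℝ (Fin n) → ℝ)
    (x : EuclideanSpace ℝ (Fin n)) : ℝ :=
  incRearr Ω u (unitBallVol n * ‖x‖ ^ n)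

/-- `Ω*`: the open ball centred at the origin with the same measure as `Ω`. -/
def symmBall {n : ℕ} (Ω : Set (EuclideanSpace ℝ (Fin n))) : Set (EuclideanSpace ℝ (Fin n)) :=
  Metric.ball 0 ((volume.real Ω / unitBallVol n) ^ (1 / (n : ℝ)))

theorem volume_symmBall {n : ℕ} (hn : 0 < n) {Ω : Set (EuclideanSpace ℝ (Fin n))}
    (hΩ : volume Ω ≠ ∞) : volume (symmBall Ω) = volume Ω := by
  have : Nonempty (Fin n) := ⟨⟨0, hn⟩⟩
  have hc : 0 < unitBallVol n :=
    ENNReal.toReal_pos (Metric.measure_ball_pos volume _ one_pos).ne' measure_ball_lt_top.ne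
  have hq : 0 ≤ volume.real Ω / unitBallVol n := div_nonneg measureReal_nonneg hc.le
  have h1 : ((volume.real Ω / unitBallVol n) ^ (1 / (n : ℝ))) ^ n
      = volume.real Ω / unitBallVol n := by
    rw [one_div, Real.rpow_inv_natCast_pow hq hn.ne']
  rw [symmBall, Measure.addHaar_ball volume _ (Real.rpow_nonneg hq _), finrank_euclideanSpace,
    Fintype.card_fin, h1,
    ← ENNReal.ofReal_toReal (measure_ball_lt_top (μ := volume)
      (x := (0 : EuclideanSpace ℝ (Fin n))) (r := 1)).ne,
    ← ENNReal.ofReal_mul hq]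
  change ENNReal.ofReal (volume.real Ω / unitBallVol n * unitBallVol n) = _
  rw [div_mul_cancel₀ _ hc.ne']
  exact ENNReal.ofReal_toReal hΩ

/-! ### The operators -/

theorem KernelH.memLp_integral {n : ℕ} {J : EuclideanSpace ℝ (Fin n) → ℝ} (hJ : KernelH J)
    {𝕜 : Type*} [RCLike 𝕜] (μ : Measure (EuclideanSpace ℝ (Fin n))) [IsFiniteMeasure μ]
    (u : Lp 𝕜 2 μ) : MemLp (fun x => ∫ y, J (x - y) • u y ∂μ) 2 μ := by
  have hu : Integrable u μ := (Lp.memLp u).integrable (by norm_num)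
  have hm : AEStronglyMeasurable (fun x => ∫ y, J (x - y) • u y ∂μ) μ := by
    have h : AEStronglyMeasurable
        (fun z : EuclideanSpace ℝ (Fin n) × EuclideanSpace ℝ (Fin n) => J (z.1 - z.2) • u z.2)
        (μ.prod μ) :=
      (hJ.continuous.comp (continuous_fst.sub continuous_snd)).aestronglyMeasurable.smul
        hu.aestronglyMeasurable.comp_snd
    exact h.integral_prod_right'
  refine MemLp.of_bound hm (∫ y, J 0 * ‖u y‖ ∂μ) (Filter.Eventually.of_forall fun x => ?_)
  refine norm_integral_le_of_norm_le (hu.norm.const_mul _) (Filter.Eventually.of_forall fun y => ?_)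
  rw [norm_smul, Real.norm_of_nonneg (hJ.nonneg _)]
  gcongr
  exact hJ.decreasing _ _ (by simp)

theorem KernelH.integrable_smul {n : ℕ} {J : EuclideanSpace ℝ (Fin n) → ℝ} (hJ : KernelH J)
    {𝕜 : Type*} [RCLike 𝕜] (μ : Measure (EuclideanSpace ℝ (Fin n))) [IsFiniteMeasure μ]
    (u : Lp 𝕜 2 μ) (x : EuclideanSpace ℝ (Fin n)) : Integrable (fun y => J (x - y) • u y) μ := by
  have hu : Integrable u μ := (Lp.memLp u).integrable (by norm_num)
  refine Integrable.mono' (hu.norm.const_mul (J 0))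
    ((hJ.continuous.comp (continuous_const.sub continuous_id)).aestronglyMeasurable.smul
      hu.aestronglyMeasurable) (Filter.Eventually.of_forall fun y => ?_)
  rw [norm_smul, Real.norm_of_nonneg (hJ.nonneg _)]
  gcongr
  exact hJ.decreasing _ _ (by simp)

theorem memLp_mul {n : ℕ} (𝕜 : Type*) [RCLike 𝕜] (μ : Measure (EuclideanSpace ℝ (Fin n)))
    {a : EuclideanSpace ℝ (Fin n) → ℝ} (ha : MemLp a ∞ μ) (u : Lp 𝕜 2 μ) :
    MemLp (fun x => a x • u x) 2 μ :=
  (Lp.memLp u).smul ha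

theorem norm_memLp_mul_le {n : ℕ} (𝕜 : Type*) [RCLike 𝕜] (μ : Measure (EuclideanSpace ℝ (Fin n)))
    {a : EuclideanSpace ℝ (Fin n) → ℝ} (ha : MemLp a ∞ μ) (u : Lp 𝕜 2 μ) :
    ‖(memLp_mul 𝕜 μ ha u).toLp _‖ ≤ (eLpNorm a ∞ μ).toReal * ‖u‖ := by
  have h : eLpNorm (a • (u : EuclideanSpace ℝ (Fin n) → 𝕜)) 2 μ
      ≤ eLpNorm a ∞ μ * eLpNorm u 2 μ :=
    eLpNorm_smul_le_mul_eLpNorm (p := ∞) (q := 2) (r := 2)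
      (Lp.aestronglyMeasurable u) ha.aestronglyMeasurable
  rw [Lp.norm_toLp, Lp.norm_def, ← ENNReal.toReal_mul]
  exact ENNReal.toReal_mono (ENNReal.mul_ne_top ha.eLpNorm_ne_top (Lp.eLpNorm_ne_top u)) h

/-- The multiplication operator `u ↦ a u` on `L²(μ)`, for an essentially bounded real `a`. -/
def mulOp {n : ℕ} (𝕜 : Type*) [RCLike 𝕜] (μ : Measure (EuclideanSpace ℝ (Fin n)))
    {a : EuclideanSpace ℝ (Fin n) → ℝ} (ha : MemLp a ∞ μ) : Lp 𝕜 2 μ →L[𝕜] Lp 𝕜 2 μ :=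
  LinearMap.mkContinuous
    { toFun := fun u => (memLp_mul 𝕜 μ ha u).toLp _
      map_add' := fun u v => by
        ext1
        filter_upwards [(memLp_mul 𝕜 μ ha (u + v)).coeFn_toLp, (memLp_mul 𝕜 μ ha u).coeFn_toLp,
          (memLp_mul 𝕜 μ ha v).coeFn_toLp, Lp.coeFn_add u v,
          Lp.coeFn_add ((memLp_mul 𝕜 μ ha u).toLp _) ((memLp_mul 𝕜 μ ha v).toLp _)]
          with x h1 h2 h3 h4 h5
        rw [h1, h5, Pi.add_apply, h2, h3, h4, Pi.add_apply, smul_add]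
      map_smul' := fun c u => by
        ext1
        filter_upwards [(memLp_mul 𝕜 μ ha (c • u)).coeFn_toLp,
          (memLp_mul 𝕜 μ ha u).coeFn_toLp, Lp.coeFn_smul c u,
          Lp.coeFn_smul c ((memLp_mul 𝕜 μ ha u).toLp _)]
          with x h1 h2 h3 h4
        rw [RingHom.id_apply, h1, h4, Pi.smul_apply, h2, h3, Pi.smul_apply, smul_comm] }
    (eLpNorm a ∞ μ).toReal
    (fun u => by
      exact norm_memLp_mul_le 𝕜 μ ha u)

theorem mulOp_apply_ae {n : ℕ} {𝕜 : Type*} [RCLike 𝕜] (μ : Measure (EuclideanSpace ℝ (Fin n)))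
    {a : EuclideanSpace ℝ (Fin n) → ℝ} (ha : MemLp a ∞ μ) (u : Lp 𝕜 2 μ) :
    mulOp 𝕜 μ ha u =ᵐ[μ] fun x => a x • u x :=
  (memLp_mul 𝕜 μ ha u).coeFn_toLp

/-- The integral operator `u ↦ ∫ J(x - y) u(y) dμ(y)` on `L²(μ)`, for a finite measure `μ`. -/
def kernelOp {n : ℕ} (𝕜 : Type*) [RCLike 𝕜] (μ : Measure (EuclideanSpace ℝ (Fin n)))
    [IsFiniteMeasure μ] {J : EuclideanSpace ℝ (Fin n) → ℝ} (hJ : KernelH J) :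
    Lp 𝕜 2 μ →L[𝕜] Lp 𝕜 2 μ :=
  LinearMap.mkContinuousOfExistsBound
    { toFun := fun u => (hJ.memLp_integral μ u).toLp _
      map_add' := fun u v => by
        rw [← MemLp.toLp_add]
        congr 1
        ext x
        rw [Pi.add_apply, ← integral_add (hJ.integrable_smul μ u x) (hJ.integrable_smul μ v x)]
        refine integral_congr_ae ?_
        filter_upwards [Lp.coeFn_add u v] with y h
        rw [h, Pi.add_apply, smul_add]
      map_smul' := fun c u => by
        rw [RingHom.id_apply, ← MemLp.toLp_const_smul]
        congr 1
        ext x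
        rw [Pi.smul_apply, ← integral_smul]
        refine integral_congr_ae ?_
        filter_upwards [Lp.coeFn_smul c u] with y h
        rw [h, Pi.smul_apply, smul_comm] }
    (by
      refine ⟨(μ univ ^ (2 : ℝ≥0∞).toReal⁻¹).toReal *
        (J 0 * (μ univ ^ (1 / (1 : ℝ≥0∞).toReal - 1 / (2 : ℝ≥0∞).toReal)).toReal), fun u => ?_⟩
      have hu : Integrable u μ := (Lp.memLp u).integrable (by norm_num)
      have h1 : ∫ y, ‖u y‖ ∂μ ≤
          ‖u‖ * (μ univ ^ (1 / (1 : ℝ≥0∞).toReal - 1 / (2 : ℝ≥0∞).toReal)).toReal := by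
        rw [integral_norm_eq_lintegral_enorm hu.aestronglyMeasurable,
          ← eLpNorm_one_eq_lintegral_enorm, Lp.norm_def, ← ENNReal.toReal_mul]
        refine ENNReal.toReal_mono (ENNReal.mul_ne_top (Lp.eLpNorm_ne_top u)
          (ENNReal.rpow_ne_top_of_nonneg (by norm_num) (measure_ne_top _ _)))
          (eLpNorm_le_eLpNorm_mul_rpow_measure_univ (by norm_num) hu.aestronglyMeasurable)
      change ‖(hJ.memLp_integral μ u).toLp _‖ ≤ _
      have h2 : ∀ x, ‖∫ y, J (x - y) • u y ∂μ‖ ≤ J 0 * ∫ y, ‖u y‖ ∂μ := fun x => by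
        rw [← integral_const_mul]
        refine norm_integral_le_of_norm_le (hu.norm.const_mul _)
          (Filter.Eventually.of_forall fun y => ?_)
        rw [norm_smul, Real.norm_of_nonneg (hJ.nonneg _)]
        gcongr
        exact hJ.decreasing _ _ (by simp)
      have h0 : 0 ≤ J 0 * ∫ y, ‖u y‖ ∂μ :=
        mul_nonneg (hJ.nonneg 0) (integral_nonneg fun _ => norm_nonneg _)
      have h3 : ‖(hJ.memLp_integral μ u).toLp _‖ ≤
          (μ univ ^ (2 : ℝ≥0∞).toReal⁻¹).toReal * (J 0 * ∫ y, ‖u y‖ ∂μ) := by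
        rw [Lp.norm_toLp]
        have := eLpNorm_le_of_ae_bound (p := 2) (μ := μ) (Filter.Eventually.of_forall h2)
        refine (ENNReal.toReal_mono (ENNReal.mul_ne_top
          (ENNReal.rpow_ne_top_of_nonneg (by norm_num) (measure_ne_top _ _))
          ENNReal.ofReal_ne_top) this).trans ?_
        rw [ENNReal.toReal_mul, ENNReal.toReal_ofReal h0]
      refine h3.trans ?_
      rw [mul_assoc, mul_assoc, mul_comm _ ‖u‖]
      gcongr
      exact hJ.nonneg 0)

theorem kernelOp_apply_ae {n : ℕ} {𝕜 : Type*} [RCLike 𝕜]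
    (μ : Measure (EuclideanSpace ℝ (Fin n))) [IsFiniteMeasure μ]
    {J : EuclideanSpace ℝ (Fin n) → ℝ} (hJ : KernelH J) (u : Lp 𝕜 2 μ) :
    kernelOp 𝕜 μ hJ u =ᵐ[μ] fun x => ∫ y, J (x - y) • u y ∂μ :=
  (hJ.memLp_integral μ u).coeFn_toLp

/-- The operator `u ↦ a u - ∫_D J(x - y) u(y) dy` on `L²(D)`, for a set `D` of finite measure and
an essentially bounded coefficient `a`. -/
def nonlocalOp {n : ℕ} (𝕜 : Type*) [RCLike 𝕜] {D : Set (EuclideanSpace ℝ (Fin n))}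
    {a J : EuclideanSpace ℝ (Fin n) → ℝ} (hJ : KernelH J) (hD : volume D ≠ ∞)
    (ha : MemLp a ∞ (volume.restrict D)) :
    Lp 𝕜 2 (volume.restrict D) →L[𝕜] Lp 𝕜 2 (volume.restrict D) :=
  haveI : IsFiniteMeasure (volume.restrict D) := isFiniteMeasure_restrict.2 hD
  mulOp 𝕜 (volume.restrict D) ha - kernelOp 𝕜 (volume.restrict D) hJ

theorem nonlocalOp_apply_ae {n : ℕ} {𝕜 : Type*} [RCLike 𝕜] {D : Set (EuclideanSpace ℝ (Fin n))}
    {a J : EuclideanSpace ℝ (Fin n) → ℝ} (hJ : KernelH J) (hD : volume D ≠ ∞)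
    (ha : MemLp a ∞ (volume.restrict D)) (u : Lp 𝕜 2 (volume.restrict D)) :
    nonlocalOp 𝕜 hJ hD ha u =ᵐ[volume.restrict D]
      fun x => a x • u x - ∫ y in D, J (x - y) • u y := by
  have : IsFiniteMeasure (volume.restrict D) := isFiniteMeasure_restrict.2 hD
  filter_upwards [Lp.coeFn_sub (mulOp 𝕜 (volume.restrict D) ha u)
    (kernelOp 𝕜 (volume.restrict D) hJ u), mulOp_apply_ae _ ha u, kernelOp_apply_ae _ hJ u]
    with x h1 h2 h3
  rw [← h2, ← h3]
  exact h1

theorem exists_bound_of_continuousOn {n : ℕ} {Ω : Set (EuclideanSpace ℝ (Fin n))}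
    (hΩ : Bornology.IsBounded Ω) {a : EuclideanSpace ℝ (Fin n) → ℝ}
    (ha : ContinuousOn a (closure Ω)) : ∃ M, 0 ≤ M ∧ ∀ x ∈ Ω, |a x| ≤ M := by
  obtain ⟨M, hM⟩ := hΩ.isCompact_closure.exists_bound_of_continuousOn ha
  exact ⟨max M 0, le_max_right _ _, fun x hx => (hM x (subset_closure hx)).trans (le_max_left _ _)⟩

theorem memLp_top_of_continuousOn {n : ℕ} {Ω : Set (EuclideanSpace ℝ (Fin n))}
    (hΩo : IsOpen Ω) (hΩ : Bornology.IsBounded Ω) {a : EuclideanSpace ℝ (Fin n) → ℝ}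
    (ha : ContinuousOn a (closure Ω)) : MemLp a ∞ (volume.restrict Ω) := by
  obtain ⟨M, -, hM⟩ := exists_bound_of_continuousOn hΩ ha
  refine memLp_top_of_bound
    ((ha.mono subset_closure).aestronglyMeasurable hΩo.measurableSet) M ?_
  filter_upwards [ae_restrict_mem hΩo.measurableSet] with x hx using hM x hx

theorem memLp_top_symmIncRearr {n : ℕ} {Ω : Set (EuclideanSpace ℝ (Fin n))}
    (hΩ : Bornology.IsBounded Ω) {a : EuclideanSpace ℝ (Fin n) → ℝ}
    (ha : ContinuousOn a (closure Ω)) (μ : Measure (EuclideanSpace ℝ (Fin n))) :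
    MemLp (symmIncRearr Ω a) ∞ μ := by
  obtain ⟨M, hM0, hM⟩ := exists_bound_of_continuousOn hΩ ha
  have hmeas : Measurable (decRearr Ω a) := by
    have : Antitone fun s : ℝ => volume {t : ℝ | 0 ≤ t ∧ s < distribFun Ω a t} :=
      fun s s' h => measure_mono fun t ht => ⟨ht.1, h.trans_lt ht.2⟩
    exact this.measurable.ennreal_toReal
  have hzero : ∀ t, M ≤ t → distribFun Ω a t = 0 := fun t ht => by
    have : {x | x ∈ Ω ∧ t < |a x|} = ∅ :=
      eq_empty_of_forall_notMem fun x hx => absurd (hM x hx.1) (not_le.2 (ht.trans_lt hx.2))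
    rw [distribFun, this, measureReal_empty]
  have hbound : ∀ s, ‖decRearr Ω a s‖ ≤ M := fun s => by
    have h0 : 0 ≤ decRearr Ω a s := ENNReal.toReal_nonneg
    rw [Real.norm_of_nonneg h0, decRearr]
    rcases le_or_gt 0 s with hs | hs
    · have hsub : {t : ℝ | 0 ≤ t ∧ s < distribFun Ω a t} ⊆ Icc 0 M := fun t ht => by
        refine ⟨ht.1, not_lt.1 fun h => ?_⟩
        have := ht.2
        rw [hzero t h.le] at this
        exact absurd hs (not_le.2 this)
      have h := measure_mono (μ := (volume : Measure ℝ)) hsub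
      rw [Real.volume_Icc, sub_zero] at h
      exact ENNReal.toReal_le_of_le_ofReal hM0 h
    · have htop : volume {t : ℝ | 0 ≤ t ∧ s < distribFun Ω a t} = ∞ := by
        have : {t : ℝ | 0 ≤ t ∧ s < distribFun Ω a t} = Ici 0 := by
          ext t
          exact ⟨fun h => h.1, fun h => ⟨h, hs.trans_le measureReal_nonneg⟩⟩
        rw [this, Real.volume_Ici]
      rw [htop]
      simpa using hM0
  refine memLp_top_of_bound (Measurable.aestronglyMeasurable ?_) M
    (Filter.Eventually.of_forall fun x => hbound _)
  exact hmeas.comp (measurable_const.sub (measurable_const.mul (measurable_norm.pow_const n)))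

/-- `B_Ω u = a u - ∫_Ω J(x - y) u(y) dy` on `L²(Ω)`. -/
def opB {n : ℕ} (𝕜 : Type*) [RCLike 𝕜] {Ω : Set (EuclideanSpace ℝ (Fin n))}
    {a J : EuclideanSpace ℝ (Fin n) → ℝ} (hJ : KernelH J) (hΩo : IsOpen Ω)
    (hΩ : Bornology.IsBounded Ω) (ha : ContinuousOn a (closure Ω)) :
    Lp 𝕜 2 (volume.restrict Ω) →L[𝕜] Lp 𝕜 2 (volume.restrict Ω) :=
  nonlocalOp 𝕜 hJ hΩ.measure_lt_top.ne (memLp_top_of_continuousOn hΩo hΩ ha)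

/-- `B*_{Ω*} u = a_* u - ∫_{Ω*} J(x - y) u(y) dy` on `L²(Ω*)`, where `a_*` is the symmetric
increasing rearrangement of the coefficient `a` on `Ω`. -/
def opBStar {n : ℕ} (𝕜 : Type*) [RCLike 𝕜] {Ω : Set (EuclideanSpace ℝ (Fin n))}
    {a J : EuclideanSpace ℝ (Fin n) → ℝ} (hJ : KernelH J)
    (hΩ : Bornology.IsBounded Ω) (ha : ContinuousOn a (closure Ω)) :
    Lp 𝕜 2 (volume.restrict (symmBall Ω)) →L[𝕜] Lp 𝕜 2 (volume.restrict (symmBall Ω)) :=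
  nonlocalOp 𝕜 (a := symmIncRearr Ω a) hJ (D := symmBall Ω) measure_ball_lt_top.ne
    (memLp_top_symmIncRearr hΩ ha _)

/-- `l` is the first eigenvalue of the bounded operator `T`: it is an eigenvalue, and it is the
minimum of the real parts of the points of the spectrum. -/
def IsFirstEigenvalue {𝕜 H : Type*} [RCLike 𝕜] [NormedAddCommGroup H] [NormedSpace 𝕜 H]
    (T : H →L[𝕜] H) (l : ℝ) : Prop :=
  Module.End.HasEigenvalue (T : H →ₗ[𝕜] H) (l : 𝕜) ∧ ∀ z ∈ spectrum 𝕜 T, l ≤ RCLike.re z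

end

/-! A lower bound of the spectrum of a bounded symmetric operator is a lower bound of its quadratic
form (`mul_norm_sq_le_reApplyInnerSelf`), while an eigenvector `u` of B gives the form of B the
value `lam * ‖u‖ ^ 2`. So it is enough to find, for functions on Ω, competitors on Ω* with the same
L² norm and no larger form.

Passing to the modulus does not raise the form, because J ≥ 0. By density the modulus may be taken
to be f = |φ| with φ smooth and compactly supported in Ω, and the competitor is a radially
decreasing function g equimeasurable with f. The potential term does not grow, since a_* is
increasing and g decreasing in |x| (Hardy–Littlewood, `setIntegral_symmIncRearr_mul_sq_le`). The
nonlocal energy ∬ g(x) J(x - y) g(y) does not drop (Riesz, `LipClass.exists_radial_rearrangement`).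

The Riesz inequality comes from polarization. Polarizing towards a half-space with the origin in its
interior preserves the distribution and the Lipschitz class, does not lower the energy, and lowers
the second moment ∫ |x|² g unless it changes nothing. By Arzelà–Ascoli the second moment has a
minimizer among the Lipschitz functions equimeasurable with f whose energy is at least that of f.
All these polarizations fix the minimizer, which is therefore radially decreasing. -/

noncomputable section

/-! ### Reflections and polarization -/

section Polarization

variable {E : Type*} [NormedAddCommGroup E] [InnerProductSpace ℝ E]

/-- The reflection across the affine hyperplane `⟪e, z⟫ = c`, for a unit vector `e`. -/
def hyperplaneRefl (e : E) (c : ℝ) (z : E) : E :=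
  z + (2 * (c - inner ℝ e z)) • e

/-- The polarization (two-point rearrangement) of `g` towards the half-space `⟪e, z⟫ ≤ c`. -/
def polarization (e : E) (c : ℝ) (g : E → ℝ) (z : E) : ℝ :=
  if inner ℝ e z ≤ c then max (g z) (g (hyperplaneRefl e c z))
  else min (g z) (g (hyperplaneRefl e c z))

variable {e : E} {c : ℝ}

theorem inner_hyperplaneRefl (he : ‖e‖ = 1) (z : E) :
    inner ℝ e (hyperplaneRefl e c z) = 2 * c - inner ℝ e z := by
  rw [hyperplaneRefl, inner_add_right, inner_smul_right, real_inner_self_eq_norm_sq, he]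
  ring

theorem hyperplaneRefl_hyperplaneRefl (he : ‖e‖ = 1) (z : E) :
    hyperplaneRefl e c (hyperplaneRefl e c z) = z := by
  rw [hyperplaneRefl, inner_hyperplaneRefl he, hyperplaneRefl, add_assoc, ← add_smul]
  convert add_zero z
  convert zero_smul ℝ e
  ring

theorem hyperplaneRefl_of_inner_eq {z : E} (hz : inner ℝ e z = c) :
    hyperplaneRefl e c z = z := by
  simp [hyperplaneRefl, hz]

/-- The correction is four times the product of the signed distances of `z` and `w` to the
hyperplane. Its sign tells whether they lie on the same side, and every later distance comparison
rests on this. -/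
theorem norm_sub_hyperplaneRefl_sq (he : ‖e‖ = 1) (z w : E) :
    ‖z - hyperplaneRefl e c w‖ ^ 2
      = ‖z - w‖ ^ 2 + 4 * (c - inner ℝ e w) * (c - inner ℝ e z) := by
  have : z - hyperplaneRefl e c w = (z - w) - (2 * (c - inner ℝ e w)) • e := by
    rw [hyperplaneRefl]; abel
  rw [this, norm_sub_sq_real, inner_smul_right, norm_smul, he, real_inner_comm e (z - w),
    inner_sub_right, mul_one, Real.norm_eq_abs, sq_abs]
  ring

theorem norm_hyperplaneRefl_sq (he : ‖e‖ = 1) (w : E) :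
    ‖hyperplaneRefl e c w‖ ^ 2 = ‖w‖ ^ 2 + 4 * c * (c - inner ℝ e w) := by
  have := norm_sub_hyperplaneRefl_sq (c := c) he 0 w
  rw [zero_sub, norm_neg, zero_sub, norm_neg, inner_zero_right] at this
  rw [this]; ring

theorem norm_hyperplaneRefl_sub_hyperplaneRefl (he : ‖e‖ = 1) (z w : E) :
    ‖hyperplaneRefl e c z - hyperplaneRefl e c w‖ = ‖z - w‖ := by
  refine (pow_left_inj₀ (norm_nonneg _) (norm_nonneg _) two_ne_zero).1 ?_
  rw [norm_sub_hyperplaneRefl_sq he, norm_sub_rev, norm_sub_hyperplaneRefl_sq he,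
    inner_hyperplaneRefl he, norm_sub_rev]
  ring

theorem norm_hyperplaneRefl_sub (he : ‖e‖ = 1) (z w : E) :
    ‖hyperplaneRefl e c z - w‖ = ‖z - hyperplaneRefl e c w‖ := by
  rw [← norm_hyperplaneRefl_sub_hyperplaneRefl (c := c) he z, hyperplaneRefl_hyperplaneRefl he]

theorem norm_sub_le_norm_sub_hyperplaneRefl (he : ‖e‖ = 1) {z w : E}
    (h : 0 ≤ (c - inner ℝ e w) * (c - inner ℝ e z)) :
    ‖z - w‖ ≤ ‖z - hyperplaneRefl e c w‖ := by
  refine (pow_le_pow_iff_left₀ (norm_nonneg _) (norm_nonneg _) two_ne_zero).1 ?_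
  rw [norm_sub_hyperplaneRefl_sq he]
  linarith

theorem norm_sub_hyperplaneRefl_le_norm_sub (he : ‖e‖ = 1) {z w : E}
    (h : (c - inner ℝ e w) * (c - inner ℝ e z) ≤ 0) :
    ‖z - hyperplaneRefl e c w‖ ≤ ‖z - w‖ := by
  refine (pow_le_pow_iff_left₀ (norm_nonneg _) (norm_nonneg _) two_ne_zero).1 ?_
  rw [norm_sub_hyperplaneRefl_sq he]
  linarith

theorem polarization_of_le {z : E} (hz : inner ℝ e z ≤ c) (g : E → ℝ) :
    polarization e c g z = max (g z) (g (hyperplaneRefl e c z)) := if_pos hz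

/-- On the hyperplane itself the reflection is the identity and max and min agree. The boundary thus
fits both formulas, and cases can be split by `le_total`. -/
theorem polarization_of_ge {z : E} (hz : c ≤ inner ℝ e z) (g : E → ℝ) :
    polarization e c g z = min (g z) (g (hyperplaneRefl e c z)) := by
  rcases hz.eq_or_lt with h | h
  · rw [polarization_of_le h.ge, hyperplaneRefl_of_inner_eq h.symm, max_self, min_self]
  · exact if_neg h.not_ge

theorem polarization_refl_of_le (he : ‖e‖ = 1) {z : E} (hz : inner ℝ e z ≤ c) (g : E → ℝ) :
    polarization e c g (hyperplaneRefl e c z) = min (g z) (g (hyperplaneRefl e c z)) := by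
  rw [polarization_of_ge (by rw [inner_hyperplaneRefl he]; linarith),
    hyperplaneRefl_hyperplaneRefl he, min_comm]

theorem polarization_refl_of_ge (he : ‖e‖ = 1) {z : E} (hz : c ≤ inner ℝ e z) (g : E → ℝ) :
    polarization e c g (hyperplaneRefl e c z) = max (g z) (g (hyperplaneRefl e c z)) := by
  rw [polarization_of_le (by rw [inner_hyperplaneRefl he]; linarith),
    hyperplaneRefl_hyperplaneRefl he, max_comm]

/-- Polarization permutes the values of `g` at a point and its mirror image. -/
theorem map_polarization_add_map_refl {β : Type*} [AddCommMonoid β] (he : ‖e‖ = 1) (F : ℝ → β)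
    (g : E → ℝ) (z : E) :
    F (polarization e c g z) + F (polarization e c g (hyperplaneRefl e c z))
      = F (g z) + F (g (hyperplaneRefl e c z)) := by
  rcases le_total (inner ℝ e z) c with h | h
  · rw [polarization_of_le h, polarization_refl_of_le he h]
    rcases le_total (g z) (g (hyperplaneRefl e c z)) with h' | h' <;> simp [h', add_comm]
  · rw [polarization_of_ge h, polarization_refl_of_ge he h]
    rcases le_total (g z) (g (hyperplaneRefl e c z)) with h' | h' <;> simp [h', add_comm]

/-- The class of Lipschitz functions with values in `[0, M]` that vanish outside a ball. -/
structure LipClass (L M R : ℝ) (g : E → ℝ) : Prop where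
  lip : ∀ x y, |g x - g y| ≤ L * ‖x - y‖
  nonneg : ∀ x, 0 ≤ g x
  le : ∀ x, g x ≤ M
  supp : ∀ x, R < ‖x‖ → g x = 0

omit [InnerProductSpace ℝ E] in
theorem LipClass.continuous {L M R : ℝ} {g : E → ℝ} (hg : LipClass L M R g) : Continuous g := by
  have : LipschitzWith L.toNNReal g := LipschitzWith.of_dist_le_mul fun x y => by
    rw [Real.dist_eq, dist_eq_norm]
    refine (hg.lip x y).trans ?_
    gcongr
    exact Real.le_coe_toNNReal L
  exact this.continuous

theorem LipClass.hasCompactSupport [FiniteDimensional ℝ E] {L M R : ℝ} {g : E → ℝ}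
    (hg : LipClass L M R g) : HasCompactSupport g := by
  have : ProperSpace E := FiniteDimensional.proper ℝ E
  refine HasCompactSupport.intro (isCompact_closedBall 0 R) fun x hx => hg.supp x ?_
  simpa using hx

theorem abs_max_sub_max_le {a b c d r : ℝ} (h1 : |a - c| ≤ r) (h2 : |b - d| ≤ r) :
    |max a b - max c d| ≤ r := (abs_max_sub_max_le_max a b c d).trans (max_le h1 h2)

theorem abs_min_sub_min_le {a b c d r : ℝ} (h1 : |a - c| ≤ r) (h2 : |b - d| ≤ r) :
    |min a b - min c d| ≤ r := (abs_min_sub_min_le_max a b c d).trans (max_le h1 h2)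

theorem abs_max_sub_min_le {a b c d r : ℝ} (h1 : |a - c| ≤ r) (h2 : |b - d| ≤ r)
    (h3 : |a - d| ≤ r) (h4 : |b - c| ≤ r) : |max a b - min c d| ≤ r := by
  rcases le_total a b with h | h <;> rcases le_total c d with h' | h' <;> simp [*]

/-- Max and min preserve the Lipschitz constant for points on one side. For points on opposite
sides, reflecting one of them only brings them closer, so all four differences of values obey the
bound. Since `0 ≤ c`, points of the favoured side are reflected away from the origin, which keeps
the support in the ball. -/
theorem LipClass.polarization {L M R : ℝ} (hL : 0 ≤ L) (he : ‖e‖ = 1) (hc : 0 ≤ c) {g : E → ℝ}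
    (hg : LipClass L M R g) : LipClass L M R (polarization e c g) where
  lip := by
    have opp : ∀ x y : E, inner ℝ e x ≤ c → c ≤ inner ℝ e y →
        |_root_.polarization e c g x - _root_.polarization e c g y| ≤ L * ‖x - y‖ := by
      intro x y hx hy
      have hd : ‖x - hyperplaneRefl e c y‖ ≤ ‖x - y‖ :=
        norm_sub_hyperplaneRefl_le_norm_sub he
          (mul_nonpos_of_nonpos_of_nonneg (by linarith) (by linarith))
      rw [polarization_of_le hx, polarization_of_ge hy]
      refine abs_max_sub_min_le (hg.lip _ _) ?_ ?_ ?_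
      · refine (hg.lip _ _).trans_eq ?_
        rw [norm_hyperplaneRefl_sub_hyperplaneRefl he]
      · exact (hg.lip _ _).trans (by gcongr)
      · refine (hg.lip _ _).trans ?_
        rw [norm_hyperplaneRefl_sub he]
        gcongr
    have hs : ∀ x y : E, |g (hyperplaneRefl e c x) - g (hyperplaneRefl e c y)| ≤ L * ‖x - y‖ :=
      fun x y => by
        refine (hg.lip _ _).trans_eq ?_
        rw [norm_hyperplaneRefl_sub_hyperplaneRefl he]
    intro x y
    rcases le_total (inner ℝ e x) c with hx | hx <;> rcases le_total (inner ℝ e y) c with hy | hy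
    · rw [polarization_of_le hx, polarization_of_le hy]
      exact abs_max_sub_max_le (hg.lip _ _) (hs _ _)
    · exact opp x y hx hy
    · rw [abs_sub_comm, norm_sub_rev]
      exact opp y x hy hx
    · rw [polarization_of_ge hx, polarization_of_ge hy]
      exact abs_min_sub_min_le (hg.lip _ _) (hs _ _)
  nonneg x := by
    unfold _root_.polarization
    split_ifs
    · exact (hg.nonneg x).trans (le_max_left _ _)
    · exact le_min (hg.nonneg _) (hg.nonneg _)
  le x := by
    unfold _root_.polarization
    split_ifs
    · exact max_le (hg.le _) (hg.le _)
    · exact (min_le_left _ _).trans (hg.le _)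
  supp x hx := by
    rcases le_total (inner ℝ e x) c with h | h
    · have : ‖x‖ ≤ ‖hyperplaneRefl e c x‖ := by
        have := norm_sub_le_norm_sub_hyperplaneRefl (c := c) he (z := 0) (w := x)
          (mul_nonneg (by linarith) (by simpa using hc))
        simpa using this
      rw [polarization_of_le h, hg.supp x hx, hg.supp _ (hx.trans_le this), max_self]
    · rw [polarization_of_ge h, hg.supp x hx, min_eq_left (hg.nonneg _)]

variable [FiniteDimensional ℝ E] [MeasurableSpace E] [BorelSpace E]

theorem measurePreserving_hyperplaneRefl (he : ‖e‖ = 1) :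
    MeasurePreserving (hyperplaneRefl e c) := by
  have h1 : MeasurePreserving ((ℝ ∙ e)ᗮ.reflection) := LinearIsometryEquiv.measurePreserving _
  have h2 := (measurePreserving_add_right (volume : Measure E) ((2 * c) • e)).comp h1
  have h3 : (hyperplaneRefl e c : E → E)
      = (fun x => x + (2 * c) • e) ∘ (ℝ ∙ e)ᗮ.reflection := by
    ext z
    rw [Function.comp_apply, Submodule.reflection_orthogonal_apply,
      Submodule.reflection_singleton_apply, he, hyperplaneRefl]
    simp only [RCLike.ofReal_real_eq_id, id, one_pow, div_one, mul_sub, sub_smul, mul_smul,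
      two_smul, neg_sub]
    abel
  rwa [h3]

theorem measurableEmbedding_hyperplaneRefl (he : ‖e‖ = 1) :
    MeasurableEmbedding (hyperplaneRefl e c : E → E) := by
  have hm : Measurable (hyperplaneRefl e c : E → E) :=
    (measurePreserving_hyperplaneRefl he).measurable
  exact (⟨⟨hyperplaneRefl e c, hyperplaneRefl e c, hyperplaneRefl_hyperplaneRefl he,
    hyperplaneRefl_hyperplaneRefl he⟩, hm, hm⟩ : E ≃ᵐ E).measurableEmbedding

/-- Twice the measure is the integral of the indicator summed over a point and its mirror image, and
this sum is unchanged because polarization only permutes the two values. -/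
theorem volume_lt_polarization (he : ‖e‖ = 1) {g : E → ℝ} (hg : Measurable g)
    (hp : Measurable (polarization e c g)) (t : ℝ) :
    volume {x | t < polarization e c g x} = volume {x | t < g x} := by
  have key : ∀ f : E → ℝ, Measurable f → 2 * volume {x | t < f x}
      = ∫⁻ x, ((Ioi t).indicator 1 (f x)
        + (Ioi t).indicator 1 (f (hyperplaneRefl e c x)) : ℝ≥0∞) := by
    intro f hf
    have hI : Measurable ((Ioi t).indicator (1 : ℝ → ℝ≥0∞)) :=
      measurable_one.indicator measurableSet_Ioi
    have h1 : ∫⁻ x, (Ioi t).indicator (1 : ℝ → ℝ≥0∞) (f x) = volume {x | t < f x} := by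
      have : (fun x => (Ioi t).indicator (1 : ℝ → ℝ≥0∞) (f x))
          = {x | t < f x}.indicator 1 := by
        ext x; simp [indicator]
      rw [this, lintegral_indicator_one (measurableSet_lt measurable_const hf)]
    rw [lintegral_add_left (f := fun x => (Ioi t).indicator (1 : ℝ → ℝ≥0∞) (f x)) (hI.comp hf),
      (measurePreserving_hyperplaneRefl he).lintegral_comp
        (f := fun x => (Ioi t).indicator (1 : ℝ → ℝ≥0∞) (f x)) (hI.comp hf), h1, two_mul]
  have h2 : 2 * volume {x | t < polarization e c g x} = 2 * volume {x | t < g x} := by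
    rw [key _ hp, key _ hg]
    exact lintegral_congr fun x => map_polarization_add_map_refl he _ g x
  exact (ENNReal.mul_right_inj two_ne_zero ENNReal.ofNat_ne_top).1 h2

end Polarization

/-! ### Effect of polarization on the Riesz energy and the second moment -/

section PolarizationFunctionals

variable {E : Type*} [NormedAddCommGroup E] [InnerProductSpace ℝ E] {e : E} {c : ℝ}

/-- The two sides agree when (A, B) and (C, D) are ordered alike; otherwise they differ by (p - q)|A
- B||C - D|. -/
theorem two_point_sum_le {p q A B C D : ℝ} (h : q ≤ p) :
    p * (A * C + B * D) + q * (B * C + A * D)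
      ≤ p * (max A B * max C D + min A B * min C D)
        + q * (min A B * max C D + max A B * min C D) := by
  rcases le_total A B with h1 | h1 <;> rcases le_total C D with h2 | h2 <;> simp only [h1, h2,
    max_eq_left, max_eq_right, min_eq_left, min_eq_right] <;>
    nlinarith [mul_nonneg (mul_nonneg (sub_nonneg.2 h) (sub_nonneg.2 h1)) (sub_nonneg.2 h2)]

/-- The integrand of the double integral `∬ g(x) J(x - y) g(y)`. -/
def rieszKernel (J g : E → ℝ) (z : E × E) : ℝ := J (z.1 - z.2) * (g z.1 * g z.2)

/-- On the four pairs formed from `x`, `y` and their images, the kernel takes only the values J(x -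
y) and J(x - σy), and the larger belongs to pairs on the same side. The two-point inequality then
applies. -/
theorem rieszKernel_four_sum_le {J : E → ℝ} (hJ : ∀ x y, ‖x‖ ≤ ‖y‖ → J y ≤ J x) (he : ‖e‖ = 1)
    (g : E → ℝ) (x y : E) :
    rieszKernel J g (x, y) + rieszKernel J g (hyperplaneRefl e c x, y)
      + (rieszKernel J g (x, hyperplaneRefl e c y)
        + rieszKernel J g (hyperplaneRefl e c x, hyperplaneRefl e c y))
    ≤ rieszKernel J (polarization e c g) (x, y)
      + rieszKernel J (polarization e c g) (hyperplaneRefl e c x, y)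
      + (rieszKernel J (polarization e c g) (x, hyperplaneRefl e c y)
        + rieszKernel J (polarization e c g) (hyperplaneRefl e c x, hyperplaneRefl e c y)) := by
  have rad : ∀ x y, ‖x‖ = ‖y‖ → J x = J y := fun x y h =>
    le_antisymm (hJ _ _ h.ge) (hJ _ _ h.le)
  have hp : J (hyperplaneRefl e c x - hyperplaneRefl e c y) = J (x - y) :=
    rad _ _ (norm_hyperplaneRefl_sub_hyperplaneRefl he x y)
  have hq : J (hyperplaneRefl e c x - y) = J (x - hyperplaneRefl e c y) :=
    rad _ _ (norm_hyperplaneRefl_sub he x y)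
  simp only [rieszKernel, hp, hq]
  have same : 0 ≤ (c - inner ℝ e y) * (c - inner ℝ e x) →
      J (x - hyperplaneRefl e c y) ≤ J (x - y) := fun h =>
    hJ _ _ (norm_sub_le_norm_sub_hyperplaneRefl he h)
  have opp : (c - inner ℝ e y) * (c - inner ℝ e x) ≤ 0 →
      J (x - y) ≤ J (x - hyperplaneRefl e c y) := fun h =>
    hJ _ _ (norm_sub_hyperplaneRefl_le_norm_sub he h)
  set A := g x
  set B := g (hyperplaneRefl e c x)
  set C := g y
  set D := g (hyperplaneRefl e c y)
  rcases le_total (inner ℝ e x) c with hx | hx <;> rcases le_total (inner ℝ e y) c with hy | hy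
  · rw [polarization_of_le hx, polarization_of_le hy, polarization_refl_of_le he hx,
      polarization_refl_of_le he hy]
    linarith [two_point_sum_le (A := A) (B := B) (C := C) (D := D)
      (same (mul_nonneg (by linarith) (by linarith)))]
  · rw [polarization_of_le hx, polarization_of_ge hy, polarization_refl_of_le he hx,
      polarization_refl_of_ge he hy]
    -- Here the image of `y`, not `y`, lies on the side of `x`, so `C` and `D` trade roles.
    have := two_point_sum_le (A := A) (B := B) (C := D) (D := C)
      (opp (mul_nonpos_of_nonpos_of_nonneg (by linarith) (by linarith)))
    rw [max_comm D C, min_comm D C] at this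
    linarith
  · rw [polarization_of_ge hx, polarization_of_le hy, polarization_refl_of_ge he hx,
      polarization_refl_of_le he hy]
    have := two_point_sum_le (A := A) (B := B) (C := D) (D := C)
      (opp (mul_nonpos_of_nonneg_of_nonpos (by linarith) (by linarith)))
    rw [max_comm D C, min_comm D C] at this
    linarith
  · rw [polarization_of_ge hx, polarization_of_ge hy, polarization_refl_of_ge he hx,
      polarization_refl_of_ge he hy]
    linarith [two_point_sum_le (A := A) (B := B) (C := C) (D := D)
      (same (mul_nonneg_of_nonpos_of_nonpos (by linarith) (by linarith)))]

variable [FiniteDimensional ℝ E] [MeasurableSpace E] [BorelSpace E]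

theorem integrable_rieszKernel {J g : E → ℝ} (hJ : Continuous J) (hg : Continuous g)
    (hs : HasCompactSupport g) :
    Integrable (rieszKernel J g) ((volume : Measure E).prod volume) := by
  have hc : Continuous (rieszKernel J g) := by unfold rieszKernel; fun_prop
  refine hc.integrable_of_hasCompactSupport
    (HasCompactSupport.intro (hs.isCompact.prod hs.isCompact) fun z hz => ?_)
  rw [mem_prod, not_and_or] at hz
  rcases hz with h | h <;> simp [rieszKernel, image_eq_zero_of_notMem_tsupport h]

/-- Reflecting either variable preserves the product measure; this turns the pointwise four-point
inequality into one between integrals. -/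
theorem integral_prod_refl (he : ‖e‖ = 1) {F : E × E → ℝ}
    (hF : Integrable F ((volume : Measure E).prod volume)) :
    Integrable (fun z : E × E => F (z.1, z.2) + F (hyperplaneRefl e c z.1, z.2)
      + (F (z.1, hyperplaneRefl e c z.2) + F (hyperplaneRefl e c z.1, hyperplaneRefl e c z.2)))
      ((volume : Measure E).prod volume) ∧
    ∫ z : E × E, (F (z.1, z.2) + F (hyperplaneRefl e c z.1, z.2)
      + (F (z.1, hyperplaneRefl e c z.2) + F (hyperplaneRefl e c z.1, hyperplaneRefl e c z.2)))
      ∂((volume : Measure E).prod volume) = 4 * ∫ z, F z ∂((volume : Measure E).prod volume) := by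
  have hσ : MeasurePreserving (hyperplaneRefl e c : E → E) := measurePreserving_hyperplaneRefl he
  have hσe : MeasurableEmbedding (hyperplaneRefl e c : E → E) :=
    measurableEmbedding_hyperplaneRefl he
  have hi : MeasurePreserving (id : E → E) := MeasurePreserving.id _
  have h1 := hσ.prod hi
  have h2 := hi.prod hσ
  have h3 := hσ.prod hσ
  have m1 := hσe.prodMap (MeasurableEmbedding.id : MeasurableEmbedding (id : E → E))
  have m2 := (MeasurableEmbedding.id : MeasurableEmbedding (id : E → E)).prodMap hσe
  have m3 := hσe.prodMap hσe
  have i1 := (h1.integrable_comp_emb m1).2 hF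
  have i2 := (h2.integrable_comp_emb m2).2 hF
  have i3 := (h3.integrable_comp_emb m3).2 hF
  have e1 := h1.integral_comp m1 F
  have e2 := h2.integral_comp m2 F
  have e3 := h3.integral_comp m3 F
  refine ⟨(hF.add i1).add (i2.add i3), ?_⟩
  have e4 := integral_add (hF.add i1) (i2.add i3)
  have e5 := integral_add hF i1
  have e6 := integral_add i2 i3
  simp only [Pi.add_apply, Function.comp_apply, Prod.map, id, Prod.mk.eta] at *
  rw [e4, e5, e6, e1, e2, e3]
  ring

theorem integral_rieszKernel_le_polarization {J : E → ℝ} (hJc : Continuous J)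
    (hJ : ∀ x y, ‖x‖ ≤ ‖y‖ → J y ≤ J x) (he : ‖e‖ = 1) (hc : 0 ≤ c) {L M R : ℝ} (hL : 0 ≤ L)
    {g : E → ℝ} (hg : LipClass L M R g) :
    ∫ z, rieszKernel J g z ∂((volume : Measure E).prod volume)
      ≤ ∫ z, rieszKernel J (polarization e c g) z ∂((volume : Measure E).prod volume) := by
  have hp := hg.polarization hL he hc
  obtain ⟨i1, e1⟩ := integral_prod_refl (c := c) he
    (integrable_rieszKernel hJc hg.continuous hg.hasCompactSupport)
  obtain ⟨i2, e2⟩ := integral_prod_refl (c := c) he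
    (integrable_rieszKernel hJc hp.continuous hp.hasCompactSupport)
  have := integral_mono i1 i2 fun z => rieszKernel_four_sum_le hJ he g z.1 z.2
  rw [e1, e2] at this
  linarith

theorem integrable_normSq_mul {g : E → ℝ} (hg : Continuous g) (hs : HasCompactSupport g) :
    Integrable (fun x => ‖x‖ ^ 2 * g x) :=
  Continuous.integrable_of_hasCompactSupport (by fun_prop) hs.mul_left

/-- If polarization does not decrease the second moment, it does not change the function on the
open half-space. -/
theorem refl_le_of_integral_normSq_le (he : ‖e‖ = 1) (hc : 0 < c) {L M R : ℝ} (hL : 0 ≤ L)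
    {g : E → ℝ} (hg : LipClass L M R g)
    (h : ∫ x, ‖x‖ ^ 2 * g x ≤ ∫ x, ‖x‖ ^ 2 * polarization e c g x) {z : E}
    (hz : inner ℝ e z < c) : g (hyperplaneRefl e c z) ≤ g z := by
  have hp := hg.polarization hL he hc.le
  set d : E → ℝ := fun x => g x - polarization e c g x with hd
  have hdσ : ∀ x, d (hyperplaneRefl e c x) = - d x := fun x => by
    have := map_polarization_add_map_refl (c := c) he id g x
    simp only [id, hd] at *
    linarith
  have hσ : MeasurePreserving (hyperplaneRefl e c : E → E) := measurePreserving_hyperplaneRefl he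
  have hσe : MeasurableEmbedding (hyperplaneRefl e c : E → E) :=
    measurableEmbedding_hyperplaneRefl he
  have ig := integrable_normSq_mul hg.continuous hg.hasCompactSupport
  have ip := integrable_normSq_mul hp.continuous hp.hasCompactSupport
  have id1 : Integrable (fun x => ‖x‖ ^ 2 * d x) := by
    refine (ig.sub ip).congr (Filter.Eventually.of_forall fun x => ?_)
    simp only [hd, mul_sub, Pi.sub_apply]
  have id2 := (hσ.integrable_comp_emb hσe).2 id1
  have h0 : ∫ x, ‖x‖ ^ 2 * d x ≤ 0 := by
    simp only [hd, mul_sub]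
    rw [integral_sub ig ip]
    linarith
  -- Since `d` is odd under the reflection, adding the integral to its reflected copy leaves the
  -- weight |x|² - |σx|² = 4c(⟪e, x⟫ - c).
  have hsum : ∫ x, 4 * c * (inner ℝ e x - c) * d x = 2 * ∫ x, ‖x‖ ^ 2 * d x := by
    have h1 := hσ.integral_comp hσe fun x => ‖x‖ ^ 2 * d x
    have h2 := integral_add id1 id2
    simp only [Function.comp_apply] at h2
    rw [h1, ← two_mul] at h2
    rw [← h2]
    refine integral_congr_ae (Filter.Eventually.of_forall fun x => ?_)
    simp only [hdσ, norm_hyperplaneRefl_sq he]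
    ring
  -- Polarization raises values on the near side and lowers them on the far side, so `d` has the
  -- sign of the weight.
  have hnn : ∀ x, 0 ≤ 4 * c * (inner ℝ e x - c) * d x := fun x => by
    rcases le_total (inner ℝ e x) c with h | h
    · refine mul_nonneg_of_nonpos_of_nonpos (mul_nonpos_of_nonneg_of_nonpos (by positivity)
        (by linarith)) ?_
      rw [hd]
      simp only [polarization_of_le h]
      linarith [le_max_left (g x) (g (hyperplaneRefl e c x))]
    · refine mul_nonneg (mul_nonneg (by positivity) (by linarith)) ?_
      rw [hd]
      simp only [polarization_of_ge h]
      linarith [min_le_left (g x) (g (hyperplaneRefl e c x))]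
  have hdc : Continuous d := hg.continuous.sub hp.continuous
  have hcont : Continuous fun x => 4 * c * (inner ℝ e x - c) * d x := by fun_prop
  have hds : HasCompactSupport d := hg.hasCompactSupport.sub hp.hasCompactSupport
  -- A continuous nonnegative function with nonpositive integral vanishes everywhere.
  have hzero : 4 * c * (inner ℝ e z - c) * d z = 0 := by
    by_contra hne
    have := hcont.integral_pos_of_hasCompactSupport_nonneg_nonzero (μ := volume) hds.mul_left hnn
      hne
    linarith
  have hdz : d z = 0 := (mul_eq_zero.1 hzero).resolve_left
    (mul_ne_zero (by positivity) (by linarith))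
  have hm := le_max_right (g z) (g (hyperplaneRefl e c z))
  simp only [hd, polarization_of_le hz.le] at hdz
  linarith

end PolarizationFunctionals

/-! ### Compactness and the radially decreasing rearrangement -/

section RadialRearrangement

open Filter Topology BoundedContinuousFunction

variable {E : Type*} [NormedAddCommGroup E] [InnerProductSpace ℝ E] [FiniteDimensional ℝ E]
  {L M R : ℝ}

/-- Arzelà–Ascoli on the closed ball of radius `R`; outside it every function is zero, so extending
the limit by zero keeps the convergence uniform. The defining inequalities pass to pointwise limits.
-/
theorem LipClass.exists_subseq_tendstoUniformly (hL : 0 ≤ L) {g : ℕ → E → ℝ}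
    (hg : ∀ k, LipClass L M R (g k)) :
    ∃ (G : E → ℝ) (φ : ℕ → ℕ), StrictMono φ ∧ LipClass L M R G ∧
      TendstoUniformly (fun k => g (φ k)) G atTop := by
  have : ProperSpace E := FiniteDimensional.proper ℝ E
  have : CompactSpace (Metric.closedBall (0 : E) R) :=
    isCompact_iff_compactSpace.1 (isCompact_closedBall 0 R)
  let F : ℕ → (Metric.closedBall (0 : E) R) →ᵇ ℝ := fun k =>
    BoundedContinuousFunction.mkOfCompact
      ⟨fun x => g k x, (hg k).continuous.comp continuous_subtype_val⟩
  have hcpt : IsCompact (closure (range F)) := by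
    refine arzela_ascoli (Icc 0 M) isCompact_Icc _ ?_ ?_
    · rintro _ x ⟨k, rfl⟩
      exact ⟨(hg k).nonneg _, (hg k).le _⟩
    · refine (LipschitzWith.uniformEquicontinuous _ L.toNNReal ?_).equicontinuous
      rintro ⟨_, k, rfl⟩
      refine LipschitzWith.of_dist_le_mul fun x y => ?_
      have h1 := (hg k).lip x y
      rw [← dist_eq_norm, ← Real.dist_eq] at h1
      rw [Real.coe_toNNReal _ hL]
      exact h1
  obtain ⟨a, -, φ, hφ, ha⟩ := hcpt.tendsto_subseq fun k => subset_closure (mem_range_self k)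
  rw [BoundedContinuousFunction.tendsto_iff_tendstoUniformly] at ha
  classical
  let G : E → ℝ := fun x => if h : x ∈ Metric.closedBall (0 : E) R then a ⟨x, h⟩ else 0
  have hGin : ∀ x (h : x ∈ Metric.closedBall (0 : E) R), G x = a ⟨x, h⟩ := fun x h => dif_pos h
  have hGout : ∀ x, R < ‖x‖ → G x = 0 := fun x h => dif_neg (by simpa using h)
  have hlim : TendstoUniformly (fun k => g (φ k)) G atTop := by
    rw [Metric.tendstoUniformly_iff] at ha ⊢
    intro ε hε
    filter_upwards [ha ε hε] with k hk x
    by_cases h : x ∈ Metric.closedBall (0 : E) R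
    · rw [hGin x h]
      exact hk ⟨x, h⟩
    · have h' : R < ‖x‖ := by simpa using h
      rwa [hGout x h', (hg _).supp x h', dist_self]
  have hpt : ∀ x, Tendsto (fun k => g (φ k) x) atTop (𝓝 (G x)) := fun x => hlim.tendsto_at x
  refine ⟨G, φ, hφ, ⟨fun x y => ?_, fun x => ?_, fun x => ?_, fun x hx => ?_⟩, hlim⟩
  · exact le_of_tendsto' ((hpt x).sub (hpt y)).abs fun k => (hg _).lip x y
  · exact ge_of_tendsto' (hpt x) fun k => (hg _).nonneg x
  · exact le_of_tendsto' (hpt x) fun k => (hg _).le x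
  · exact hGout x hx

variable [MeasurableSpace E] [BorelSpace E]

/-- Functions within ε of each other have superlevel sets nested up to a shift ε of the level.
Continuity of measure along increasing unions removes the shift, because the superlevel sets are
strict. -/
theorem volume_lt_eq_of_tendstoUniformly {g : ℕ → E → ℝ} {G f : E → ℝ}
    (h : TendstoUniformly g G atTop)
    (hg : ∀ k t, volume {x | t < g k x} = volume {x | t < f x}) (t : ℝ) :
    volume {x | t < G x} = volume {x | t < f x} := by
  have approx : ∀ u : E → ℝ, ∀ C : ℝ≥0∞, (∀ ε > 0, volume {x | t + ε < u x} ≤ C) →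
      volume {x | t < u x} ≤ C := by
    intro u C hC
    have : {x | t < u x} = ⋃ m : ℕ, {x | t + 1 / ((m : ℝ) + 1) < u x} := by
      ext x
      simp only [mem_ofPred_eq, mem_iUnion]
      refine ⟨fun hx => ?_, fun ⟨m, hm⟩ => by
        linarith [Nat.one_div_pos_of_nat (α := ℝ) (n := m)]⟩
      obtain ⟨m, hm⟩ := exists_nat_one_div_lt (sub_pos.2 hx)
      exact ⟨m, by linarith⟩
    rw [this, Monotone.measure_iUnion]
    · exact iSup_le fun m => hC _ Nat.one_div_pos_of_nat
    · intro m m' hm x hx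
      simp only [mem_ofPred_eq] at *
      have : 1 / ((m' : ℝ) + 1) ≤ 1 / ((m : ℝ) + 1) := Nat.one_div_le_one_div hm
      linarith
  rw [Metric.tendstoUniformly_iff] at h
  refine le_antisymm (approx _ _ fun ε hε => ?_) (approx _ _ fun ε hε => ?_)
  · obtain ⟨k, hk⟩ := (h ε hε).exists
    rw [← hg k]
    refine measure_mono fun x hx => ?_
    have := (abs_lt.1 (Real.dist_eq _ _ ▸ hk x)).2
    simp only [mem_ofPred_eq] at *
    linarith
  · obtain ⟨k, hk⟩ := (h ε hε).exists
    rw [← hg k]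
    refine measure_mono fun x hx => ?_
    have := (abs_lt.1 (Real.dist_eq _ _ ▸ hk x)).1
    simp only [mem_ofPred_eq] at *
    linarith

theorem tendsto_integral_normSq_mul {g : ℕ → E → ℝ} {G : E → ℝ}
    (hg : ∀ k, LipClass L M R (g k)) (h : ∀ x, Tendsto (fun k => g k x) atTop (𝓝 (G x))) :
    Tendsto (fun k => ∫ x, ‖x‖ ^ 2 * g k x) atTop (𝓝 (∫ x, ‖x‖ ^ 2 * G x)) := by
  have : ProperSpace E := FiniteDimensional.proper ℝ E
  refine tendsto_integral_of_dominated_convergence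
    ((Metric.closedBall (0 : E) R).indicator fun _ => R ^ 2 * M) (fun k => ?_) ?_ (fun k => ?_) ?_
  · exact ((continuous_norm.pow 2).mul (hg k).continuous).aestronglyMeasurable
  · rw [integrable_indicator_iff measurableSet_closedBall]
    exact integrableOn_const (isCompact_closedBall 0 R).measure_lt_top.ne
  · refine Eventually.of_forall fun x => ?_
    rw [Real.norm_of_nonneg (mul_nonneg (by positivity) ((hg k).nonneg x))]
    by_cases hx : x ∈ Metric.closedBall (0 : E) R
    · rw [indicator_of_mem hx]
      rw [mem_closedBall_zero_iff] at hx
      have h1 := (hg k).nonneg x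
      have h2 := (hg k).le x
      gcongr
    · rw [indicator_of_notMem hx, (hg k).supp x (by simpa using hx), mul_zero]
  · exact Eventually.of_forall fun x => (h x).const_mul _

theorem tendsto_integral_rieszKernel {J : E → ℝ} (hJc : Continuous J) (hJ0 : ∀ x, 0 ≤ J x)
    (hJ : ∀ x y, ‖x‖ ≤ ‖y‖ → J y ≤ J x) {g : ℕ → E → ℝ} {G : E → ℝ}
    (hg : ∀ k, LipClass L M R (g k)) (h : ∀ x, Tendsto (fun k => g k x) atTop (𝓝 (G x))) :
    Tendsto (fun k => ∫ z, rieszKernel J (g k) z ∂((volume : Measure E).prod volume)) atTop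
      (𝓝 (∫ z, rieszKernel J G z ∂((volume : Measure E).prod volume))) := by
  have : ProperSpace E := FiniteDimensional.proper ℝ E
  have hK : IsCompact (Metric.closedBall (0 : E) R ×ˢ Metric.closedBall (0 : E) R) :=
    (isCompact_closedBall 0 R).prod (isCompact_closedBall 0 R)
  refine tendsto_integral_of_dominated_convergence
    ((Metric.closedBall (0 : E) R ×ˢ Metric.closedBall (0 : E) R).indicator
      fun _ => J 0 * (M * M)) (fun k => ?_) ?_ (fun k => ?_) ?_
  · exact (integrable_rieszKernel hJc (hg k).continuous
      (hg k).hasCompactSupport).aestronglyMeasurable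
  · rw [integrable_indicator_iff (measurableSet_closedBall.prod measurableSet_closedBall)]
    exact integrableOn_const hK.measure_lt_top.ne
  · refine Eventually.of_forall fun z => ?_
    rw [rieszKernel, Real.norm_of_nonneg
      (mul_nonneg (hJ0 _) (mul_nonneg ((hg k).nonneg _) ((hg k).nonneg _)))]
    by_cases hz : z ∈ Metric.closedBall (0 : E) R ×ˢ Metric.closedBall (0 : E) R
    · rw [indicator_of_mem hz]
      have h1 := (hg k).nonneg
      have h2 := (hg k).le
      have h3 := hJ 0 (z.1 - z.2) (by simp)
      have h4 := hJ0 0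
      have h5 := (h1 z.1).trans (h2 z.1)
      gcongr
      exacts [mul_nonneg (h1 _) (h1 _), h1 _, h2 _, h2 _]
    · rw [indicator_of_notMem hz]
      rw [mem_prod, not_and_or] at hz
      rcases hz with hz | hz <;> simp [(hg k).supp _ (by simpa using hz)]
  · exact Eventually.of_forall fun z => ((h z.1).mul (h z.2)).const_mul _

/-- The hyperplane is the perpendicular bisector of `x` and `y`; `0 < c` because the origin is
strictly closer to `x`. -/
theorem exists_hyperplaneRefl_eq {E : Type*} [NormedAddCommGroup E] [InnerProductSpace ℝ E]
    {x y : E} (h : ‖x‖ < ‖y‖) :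
    ∃ (e : E) (c : ℝ), ‖e‖ = 1 ∧ 0 < c ∧ inner ℝ e x < c ∧ hyperplaneRefl e c x = y := by
  have hd : 0 < ‖y - x‖ := norm_pos_iff.2 fun h' => by
    rw [sub_eq_zero.1 h'] at h; exact lt_irrefl _ h
  have key : (‖y‖ ^ 2 - ‖x‖ ^ 2) / (2 * ‖y - x‖) - inner ℝ (‖y - x‖⁻¹ • (y - x)) x
      = ‖y - x‖ / 2 := by
    have h1 := norm_sub_sq_real y x
    rw [real_inner_smul_left, inner_sub_left, real_inner_self_eq_norm_sq]
    field_simp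
    linarith
  refine ⟨‖y - x‖⁻¹ • (y - x), (‖y‖ ^ 2 - ‖x‖ ^ 2) / (2 * ‖y - x‖), ?_, ?_, ?_, ?_⟩
  · rw [norm_smul, norm_inv, norm_norm, inv_mul_cancel₀ hd.ne']
  · refine div_pos (sub_pos.2 ?_) (by positivity)
    gcongr
  · linarith
  · rw [hyperplaneRefl, key, smul_smul]
    rw [mul_div_cancel₀ _ two_ne_zero, mul_inv_cancel₀ hd.ne', one_smul, add_sub_cancel]

/-- A Lipschitz function has a radially decreasing equimeasurable rearrangement which does not
decrease the Riesz energy. -/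
theorem LipClass.exists_radial_rearrangement {J : E → ℝ} (hJc : Continuous J) (hJ0 : ∀ x, 0 ≤ J x)
    (hJ : ∀ x y, ‖x‖ ≤ ‖y‖ → J y ≤ J x) (hL : 0 ≤ L) {f : E → ℝ} (hf : LipClass L M R f) :
    ∃ g : E → ℝ, LipClass L M R g ∧ (∀ x y, ‖x‖ ≤ ‖y‖ → g y ≤ g x) ∧
      (∀ t, volume {x | t < g x} = volume {x | t < f x}) ∧
      ∫ z, rieszKernel J f z ∂((volume : Measure E).prod volume)
        ≤ ∫ z, rieszKernel J g z ∂((volume : Measure E).prod volume) := by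
  let Q : (E → ℝ) → ℝ := fun g => ∫ z, rieszKernel J g z ∂((volume : Measure E).prod volume)
  let mom : (E → ℝ) → ℝ := fun g => ∫ x, ‖x‖ ^ 2 * g x
  -- The admissible class is closed under limits and under polarization with `0 ≤ c`; the second
  -- moment is minimized over it.
  let S : Set (E → ℝ) := {g | LipClass L M R g ∧
    (∀ t, volume {x | t < g x} = volume {x | t < f x}) ∧ Q f ≤ Q g}
  have hbdd : BddBelow (mom '' S) := by
    refine ⟨0, ?_⟩
    rintro _ ⟨g, hg, rfl⟩
    exact integral_nonneg fun x => mul_nonneg (by positivity) (hg.1.nonneg x)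
  have hne : (mom '' S).Nonempty := ⟨_, f, ⟨hf, fun t => rfl, le_rfl⟩, rfl⟩
  obtain ⟨u, -, hu, huS⟩ := exists_seq_tendsto_sInf hne hbdd
  choose g hgS hgu using huS
  obtain ⟨G, φ, hφ, hG, hlim⟩ := LipClass.exists_subseq_tendstoUniformly hL fun k => (hgS k).1
  have hpt : ∀ x, Tendsto (fun k => g (φ k) x) atTop (𝓝 (G x)) := fun x => hlim.tendsto_at x
  have hGS : G ∈ S := by
    refine ⟨hG, volume_lt_eq_of_tendstoUniformly hlim fun k => (hgS _).2.1, ?_⟩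
    exact ge_of_tendsto' (tendsto_integral_rieszKernel hJc hJ0 hJ (fun k => (hgS (φ k)).1) hpt)
      fun k => (hgS _).2.2
  have hGmom : mom G = sInf (mom '' S) := by
    refine tendsto_nhds_unique (tendsto_integral_normSq_mul (fun k => (hgS (φ k)).1) hpt) ?_
    have := hu.comp hφ.tendsto_atTop
    simp only [Function.comp_def, ← hgu] at this
    exact this
  -- Polarizing the minimizer across the bisector of `x` and `y` stays in `S`, so it cannot lower
  -- the moment, and the values at `x` and `y` must already be in order.
  have hlt : ∀ x y, ‖x‖ < ‖y‖ → G y ≤ G x := by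
    intro x y hxy
    obtain ⟨e, c, he, hc, hx, rfl⟩ := exists_hyperplaneRefl_eq hxy
    have hp := hG.polarization hL he hc.le
    have hpS : _root_.polarization e c G ∈ S := by
      refine ⟨hp, fun t => ?_, ?_⟩
      · rw [volume_lt_polarization he hG.continuous.measurable hp.continuous.measurable]
        exact hGS.2.1 t
      · exact hGS.2.2.trans (integral_rieszKernel_le_polarization hJc hJ he hc.le hL hG)
    refine refl_le_of_integral_normSq_le he hc hL hG ?_ hx
    change mom G ≤ mom _
    rw [hGmom]
    exact csInf_le hbdd ⟨_, hpS, rfl⟩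
  refine ⟨G, hG, fun x y hxy => ?_, hGS.2⟩
  rcases hxy.lt_or_eq with h | h
  · exact hlt x y h
  by_cases hy : y = 0
  · subst hy
    rw [norm_zero, norm_eq_zero] at h
    rw [h]
  -- For equal norms, approach `y` by the strictly longer vectors (1 + ε)y and use continuity.
  have ht : Tendsto (fun ε : ℝ => G ((1 + ε) • y)) (𝓝[>] 0) (𝓝 (G y)) := by
    have hc : Continuous fun ε : ℝ => G ((1 + ε) • y) :=
      hG.continuous.comp (by fun_prop)
    have := (hc.tendsto 0).mono_left (nhdsWithin_le_nhds (s := Ioi 0))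
    simpa using this
  refine le_of_tendsto ht ?_
  filter_upwards [self_mem_nhdsWithin] with ε hε
  refine hlt _ _ ?_
  rw [norm_smul, Real.norm_of_nonneg (by linarith [mem_Ioi.1 hε]), h]
  nlinarith [mem_Ioi.1 hε, norm_pos_iff.2 hy]

end RadialRearrangement

/-! ### Layer-cake formulas and the Hardy–Littlewood inequality -/

section HardyLittlewood

/-- The layer-cake formula is applied twice: to `a` under the measure with density `w`, then to `w`
on each superlevel set of `a`. -/
theorem lintegral_mul_eq_lintegral_meas_lt {α : Type*} [MeasurableSpace α] (μ : Measure α)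
    {a w : α → ℝ} (ha : Measurable a) (hw : Measurable w) (ha0 : ∀ x, 0 ≤ a x)
    (hw0 : ∀ x, 0 ≤ w x) :
    ∫⁻ x, ENNReal.ofReal (a x * w x) ∂μ
      = ∫⁻ s in Ioi 0, ∫⁻ t in Ioi 0, μ ({x | t < w x} ∩ {x | s < a x}) := by
  have h1 : ∫⁻ x, ENNReal.ofReal (a x * w x) ∂μ
      = ∫⁻ x, ENNReal.ofReal (a x) ∂(μ.withDensity fun x => ENNReal.ofReal (w x)) := by
    rw [lintegral_withDensity_eq_lintegral_mul _ hw.ennreal_ofReal ha.ennreal_ofReal]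
    refine lintegral_congr fun x => ?_
    rw [Pi.mul_apply, mul_comm, ENNReal.ofReal_mul (hw0 x)]
  rw [h1, lintegral_eq_lintegral_meas_lt _ (Filter.Eventually.of_forall ha0) ha.aemeasurable]
  refine lintegral_congr fun s => ?_
  rw [withDensity_apply _ (measurableSet_lt measurable_const ha),
    lintegral_eq_lintegral_meas_lt _ (Filter.Eventually.of_forall hw0) hw.aemeasurable]
  refine lintegral_congr fun t => ?_
  rw [Measure.restrict_apply (measurableSet_lt measurable_const hw)]

theorem lintegral_mul_le_of_measure_le {α β : Type*} [MeasurableSpace α] [MeasurableSpace β]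
    (μ : Measure α) (ν : Measure β) {a w : α → ℝ} {b v : β → ℝ} (ha : Measurable a)
    (hw : Measurable w) (hb : Measurable b) (hv : Measurable v) (ha0 : ∀ x, 0 ≤ a x)
    (hw0 : ∀ x, 0 ≤ w x) (hb0 : ∀ x, 0 ≤ b x) (hv0 : ∀ x, 0 ≤ v x)
    (h : ∀ s > 0, ∀ t > 0, μ ({x | t < w x} ∩ {x | s < a x}) ≤ ν ({x | t < v x} ∩ {x | s < b x})) :
    ∫⁻ x, ENNReal.ofReal (a x * w x) ∂μ ≤ ∫⁻ x, ENNReal.ofReal (b x * v x) ∂ν := by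
  rw [lintegral_mul_eq_lintegral_meas_lt μ ha hw ha0 hw0,
    lintegral_mul_eq_lintegral_meas_lt ν hb hv hb0 hv0]
  refine setLIntegral_mono' measurableSet_Ioi fun s hs => ?_
  exact setLIntegral_mono' measurableSet_Ioi fun t ht => h s hs t ht

variable {n : ℕ}

theorem decRearr_le_of_distribFun_le {Ω : Set (EuclideanSpace ℝ (Fin n))}
    (hΩ : volume Ω ≠ ∞) {u : EuclideanSpace ℝ (Fin n) → ℝ} {r s : ℝ} (hs : 0 ≤ s)
    (h : distribFun Ω u s ≤ r) : decRearr Ω u r ≤ s := by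
  have hsub : {t : ℝ | 0 ≤ t ∧ r < distribFun Ω u t} ⊆ Icc 0 s := fun t ht => by
    refine ⟨ht.1, not_lt.1 fun hst => ht.2.not_ge (le_trans ?_ h)⟩
    refine measureReal_mono (fun x hx => ⟨hx.1, hst.trans hx.2⟩) ?_
    exact ((measure_mono fun x hx => hx.1).trans_lt hΩ.lt_top).ne
  have h := measure_mono (μ := (volume : Measure ℝ)) hsub
  rw [Real.volume_Icc, sub_zero] at h
  exact ENNReal.toReal_le_of_le_ofReal hs h

theorem decRearr_nonneg (Ω : Set (EuclideanSpace ℝ (Fin n)))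
    (u : EuclideanSpace ℝ (Fin n) → ℝ) (s : ℝ) : 0 ≤ decRearr Ω u s := ENNReal.toReal_nonneg

theorem measurable_symmIncRearr (Ω : Set (EuclideanSpace ℝ (Fin n)))
    (u : EuclideanSpace ℝ (Fin n) → ℝ) : Measurable (symmIncRearr Ω u) := by
  have hmeas : Measurable (decRearr Ω u) := by
    have : Antitone fun s : ℝ => volume {t : ℝ | 0 ≤ t ∧ s < distribFun Ω u t} :=
      fun s s' h => measure_mono fun t ht => ⟨ht.1, h.trans_lt ht.2⟩
    exact this.measurable.ennreal_toReal
  exact hmeas.comp (measurable_const.sub (measurable_const.mul (measurable_norm.pow_const n)))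

/-- The ball has measure |Ω| - μ(s), so its points satisfy μ(s) < |Ω| - c_n|x|ⁿ, and a^# is at most
s there. Only this half of the equimeasurability of a and a_* is needed. -/
theorem symmIncRearr_le_of_mem_symmBall (hn : 0 < n) {Ω : Set (EuclideanSpace ℝ (Fin n))}
    (hΩ : volume Ω ≠ ∞) {u : EuclideanSpace ℝ (Fin n) → ℝ} {s : ℝ}
    (hm : MeasurableSet {x | x ∈ Ω ∧ s < |u x|}) (hs : 0 ≤ s)
    {x : EuclideanSpace ℝ (Fin n)} (hx : x ∈ symmBall (Ω \ {x | x ∈ Ω ∧ s < |u x|})) :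
    symmIncRearr Ω u x ≤ s := by
  have : Nonempty (Fin n) := ⟨⟨0, hn⟩⟩
  refine decRearr_le_of_distribFun_le hΩ hs ?_
  have hc : 0 < unitBallVol n :=
    ENNReal.toReal_pos (Metric.measure_ball_pos volume _ one_pos).ne' measure_ball_lt_top.ne
  have hd : volume.real (Ω \ {x | x ∈ Ω ∧ s < |u x|})
      = volume.real Ω - volume.real {x | x ∈ Ω ∧ s < |u x|} :=
    measureReal_sdiff (fun x hx => hx.1) hm hΩ
  rw [symmBall, mem_ball_zero_iff, hd] at hx
  have hq : 0 ≤ (volume.real Ω - volume.real {x | x ∈ Ω ∧ s < |u x|}) / unitBallVol n :=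
    div_nonneg (hd ▸ measureReal_nonneg) hc.le
  have h1 := pow_lt_pow_left₀ hx (norm_nonneg _) hn.ne'
  rw [one_div, Real.rpow_inv_natCast_pow hq hn.ne', lt_div_iff₀ hc] at h1
  rw [distribFun]
  linarith

/-- Such sets are centred balls, open or closed, or trivial, hence nested. -/
theorem subset_or_subset_of_norm_lower {E : Type*} [NormedAddCommGroup E] {U V : Set E}
    (hU : ∀ x ∈ U, ∀ y, ‖y‖ ≤ ‖x‖ → y ∈ U) (hV : ∀ x ∈ V, ∀ y, ‖y‖ ≤ ‖x‖ → y ∈ V) :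
    U ⊆ V ∨ V ⊆ U := by
  by_contra! h
  obtain ⟨⟨x, hxU, hxV⟩, ⟨y, hyV, hyU⟩⟩ := h.imp not_subset.1 not_subset.1
  rcases le_total ‖x‖ ‖y‖ with h | h
  · exact hxV (hV y hyV x h)
  · exact hyU (hU x hxU y h)

theorem symmBall_norm_lower (Ω : Set (EuclideanSpace ℝ (Fin n))) :
    ∀ x ∈ symmBall Ω, ∀ y, ‖y‖ ≤ ‖x‖ → y ∈ symmBall Ω := by
  intro x hx y h
  rw [symmBall, mem_ball_zero_iff] at *
  exact h.trans_lt hx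

variable {Ω : Set (EuclideanSpace ℝ (Fin n))} {f g : EuclideanSpace ℝ (Fin n) → ℝ}

/-- A radially decreasing function equimeasurable with a function supported in `Ω` vanishes almost
everywhere outside `Ω*`. -/
theorem ae_eq_zero_of_notMem_symmBall (hn : 0 < n) (hΩ : volume Ω ≠ ∞)
    (hf : ∀ x ∉ Ω, f x = 0) (hg0 : ∀ x, 0 ≤ g x) (hgr : ∀ x y, ‖x‖ ≤ ‖y‖ → g y ≤ g x)
    (h : ∀ t, volume {x | t < g x} = volume {x | t < f x}) :
    ∀ᵐ x, x ∉ symmBall Ω → g x = 0 := by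
  have hle : volume {x | 0 < g x} ≤ volume (symmBall Ω) := by
    rw [h, volume_symmBall hn hΩ]
    refine measure_mono fun x hx => ?_
    by_contra hxΩ
    exact hx.ne' (hf x hxΩ)
  have hz : volume ({x | 0 < g x} \ symmBall Ω) = 0 := by
    rcases subset_or_subset_of_norm_lower
      (fun x hx y hxy => lt_of_lt_of_le hx (hgr y x hxy) :
        ∀ x ∈ {x | 0 < g x}, ∀ y, ‖y‖ ≤ ‖x‖ → y ∈ {x | 0 < g x})
      (symmBall_norm_lower Ω) with h' | h'
    · rw [sdiff_eq_empty.2 h', measure_empty]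
    · rw [measure_sdiff h' Metric.isOpen_ball.measurableSet.nullMeasurableSet
        measure_ball_lt_top.ne]
      exact tsub_eq_zero_of_le hle
  filter_upwards [measure_eq_zero_iff_ae_notMem.1 hz] with x hx hxΩ
  refine le_antisymm (not_lt.1 fun hlt => hx ⟨hlt, hxΩ⟩) (hg0 x)

theorem integral_sq_eq_of_equimeasurable {α : Type*} [MeasurableSpace α] {μ : Measure α}
    {f g : α → ℝ} (hf : Measurable f) (hg : Measurable g) (hf0 : ∀ x, 0 ≤ f x)
    (hg0 : ∀ x, 0 ≤ g x) (h : ∀ t, μ {x | t < g x} = μ {x | t < f x}) :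
    ∫ x, g x ^ 2 ∂μ = ∫ x, f x ^ 2 ∂μ := by
  have key : ∀ {u : α → ℝ}, Measurable u → (∀ x, 0 ≤ u x) →
      ∫ x, u x ^ 2 ∂μ = (∫⁻ t in Ioi 0, μ {x | √t < u x}).toReal := by
    intro u hu hu0
    rw [integral_eq_lintegral_of_nonneg_ae (Filter.Eventually.of_forall fun x => sq_nonneg _)
      (hu.pow_const 2).aestronglyMeasurable, lintegral_eq_lintegral_meas_lt _
      (Filter.Eventually.of_forall fun x => sq_nonneg _) (hu.pow_const 2).aemeasurable]
    congr 1
    refine setLIntegral_congr_fun measurableSet_Ioi fun t ht => ?_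
    congr 1
    ext x
    exact (Real.sqrt_lt (le_of_lt ht) (hu0 x)).symm
  rw [key hf hf0, key hg hg0]
  simp only [h]

/-- By layer cake, superlevel sets suffice. With Ωs = {x ∈ Ω : a ≤ s}, the set for g and a_* lies in
{g > √t} minus the ball Ωs*. These sets are nested, so the difference is empty or has measure |{f >
√t}| - |Ωs|, which is at most |{f > √t} \ Ωs|. -/
theorem setIntegral_symmIncRearr_mul_sq_le (hn : 0 < n) (hΩo : IsOpen Ω)
    (hΩb : Bornology.IsBounded Ω) {a : EuclideanSpace ℝ (Fin n) → ℝ}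
    (ha : ContinuousOn a (closure Ω)) (ha0 : ∀ x ∈ closure Ω, 0 ≤ a x)
    (hf : Continuous f) (hfs : HasCompactSupport f) (hf0 : ∀ x, 0 ≤ f x) (hfΩ : ∀ x ∉ Ω, f x = 0)
    (hg : Measurable g) (hg0 : ∀ x, 0 ≤ g x) (hgr : ∀ x y, ‖x‖ ≤ ‖y‖ → g y ≤ g x)
    (h : ∀ t, volume {x | t < g x} = volume {x | t < f x}) :
    ∫ x in symmBall Ω, symmIncRearr Ω a x * g x ^ 2 ≤ ∫ x in Ω, a x * f x ^ 2 := by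
  have hΩ : volume Ω ≠ ∞ := hΩb.measure_lt_top.ne
  have hind : Measurable (Ω.indicator a) := by
    classical
    rw [← piecewise_eq_indicator]
    exact (ha.mono subset_closure).measurable_piecewise continuousOn_const hΩo.measurableSet
  have hsymm0 : ∀ x, 0 ≤ symmIncRearr Ω a x := fun x => decRearr_nonneg _ _ _
  have hind0 : ∀ x, 0 ≤ Ω.indicator a x :=
    indicator_nonneg fun x hx => ha0 x (subset_closure hx)
  -- Positivity of the level makes the zero extension of `a` harmless.
  have hset : ∀ s > 0, {x | x ∈ Ω ∧ s < |a x|} = {x | s < Ω.indicator a x} := by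
    intro s hs
    ext x
    by_cases hx : x ∈ Ω
    · simp [hx, abs_of_nonneg (ha0 x (subset_closure hx))]
    · simp [hx, hs.le]
  have hcmp := lintegral_mul_le_of_measure_le (volume.restrict (symmBall Ω)) (volume.restrict Ω)
    (measurable_symmIncRearr Ω a) (hg.pow_const 2) hind (hf.measurable.pow_const 2)
    hsymm0 (fun x => sq_nonneg _) hind0 (fun x => sq_nonneg _) ?_
  · have e1 : ∫ x in Ω, a x * f x ^ 2 = ∫ x in Ω, Ω.indicator a x * f x ^ 2 :=
      setIntegral_congr_fun hΩo.measurableSet fun x hx => by simp [hx]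
    rw [e1, integral_eq_lintegral_of_nonneg_ae
      (Filter.Eventually.of_forall fun x => mul_nonneg (hsymm0 x) (sq_nonneg _))
      ((measurable_symmIncRearr Ω a).mul (hg.pow_const 2)).aestronglyMeasurable,
      integral_eq_lintegral_of_nonneg_ae
      (Filter.Eventually.of_forall fun x => mul_nonneg (hind0 x) (sq_nonneg _))
      (hind.mul (hf.measurable.pow_const 2)).aestronglyMeasurable]
    -- The right side must be finite, since `toReal` sends an infinite integral to 0.
    refine ENNReal.toReal_mono ?_ hcmp
    obtain ⟨M, hM0, hM⟩ := exists_bound_of_continuousOn hΩb ha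
    have hint : Integrable (fun x => Ω.indicator a x * f x ^ 2) (volume.restrict Ω) := by
      have hf2 : Integrable (fun x => f x ^ 2) :=
        (hf.pow 2).integrable_of_hasCompactSupport (by
          simpa only [sq] using hfs.mul_left (f := f))
      refine hf2.restrict.bdd_mul (c := M) hind.aestronglyMeasurable ?_
      filter_upwards [ae_restrict_mem hΩo.measurableSet] with x hx
      rw [indicator_of_mem hx]
      exact hM x hx
    exact (lintegral_ofReal_le_lintegral_enorm _).trans_lt hint.2 |>.ne
  · intro s hs t ht
    have hsm : MeasurableSet {x | x ∈ Ω ∧ s < |a x|} := by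
      rw [hset s hs]
      exact measurableSet_lt measurable_const hind
    have hgt : {x | t < g x ^ 2} = {x | √t < g x} :=
      ext fun x => (Real.sqrt_lt ht.le (hg0 x)).symm
    have hft : {x | t < f x ^ 2} = {x | √t < f x} :=
      ext fun x => (Real.sqrt_lt ht.le (hf0 x)).symm
    rw [hgt, hft, ← hset s hs, Measure.restrict_apply ((measurableSet_lt measurable_const hg).inter
      (measurableSet_lt measurable_const (measurable_symmIncRearr Ω a))),
      Measure.restrict_apply ((measurableSet_lt measurable_const hf.measurable).inter hsm)]
    set Ωs := Ω \ {x | x ∈ Ω ∧ s < |a x|} with hΩs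
    have hvs : volume Ωs ≠ ∞ := ((measure_mono sdiff_subset).trans_lt hΩ.lt_top).ne
    have h1 : {x | √t < g x} ∩ {x | s < symmIncRearr Ω a x} ∩ symmBall Ω
        ⊆ {x | √t < g x} \ symmBall Ωs := by
      rintro x ⟨⟨hx1, hx2⟩, -⟩
      exact ⟨hx1, fun hx => hx2.not_ge (symmIncRearr_le_of_mem_symmBall hn hΩ hsm hs.le hx)⟩
    have h2 : {x | √t < f x} \ Ωs ⊆ {x | √t < f x} ∩ {x | x ∈ Ω ∧ s < |a x|} ∩ Ω := by
      rintro x ⟨hx1, hx2⟩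
      have hxΩ : x ∈ Ω := by
        by_contra hx
        have : √t < f x := hx1
        rw [hfΩ x hx] at this
        exact this.not_ge (Real.sqrt_nonneg t)
      have hx3 : x ∈ {x | x ∈ Ω ∧ s < |a x|} := by
        by_contra hx
        exact hx2 ⟨hxΩ, hx⟩
      exact ⟨⟨hx1, hx3⟩, hxΩ⟩
    refine (measure_mono h1).trans (le_trans ?_ (measure_mono h2))
    rcases subset_or_subset_of_norm_lower
      (fun x hx y hxy => lt_of_lt_of_le hx (hgr y x hxy) :
        ∀ x ∈ {x | √t < g x}, ∀ y, ‖y‖ ≤ ‖x‖ → y ∈ {x | √t < g x})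
      (symmBall_norm_lower Ωs) with h' | h'
    · rw [sdiff_eq_empty.2 h', measure_empty]
      exact zero_le
    · rw [measure_sdiff h' Metric.isOpen_ball.measurableSet.nullMeasurableSet
        measure_ball_lt_top.ne, h, volume_symmBall hn hvs]
      exact le_measure_sdiff

end HardyLittlewood

/-! ### Spectral lower bounds and quadratic forms -/

section Spectrum

variable {𝕜 H : Type*} [RCLike 𝕜] [NormedAddCommGroup H] [InnerProductSpace 𝕜 H]

/-- Nonnegativity of the form at v - K⁻¹Sv with K = ‖S‖ + 1, expanded, gives the bound. Adding 1
keeps K positive even when S = 0. -/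
theorem norm_sq_le_mul_reApplyInnerSelf {S : H →L[𝕜] H} (hS : (S : H →ₗ[𝕜] H).IsSymmetric)
    (hpos : ∀ v, 0 ≤ S.reApplyInnerSelf v) (v : H) :
    ‖S v‖ ^ 2 ≤ (‖S‖ + 1) * S.reApplyInnerSelf v := by
  set K := ‖S‖ + 1 with hKdef
  have hK : 0 < K := by positivity
  have h := hpos (v + ((-K⁻¹ : ℝ) : 𝕜) • S v)
  have hsym : inner 𝕜 (S (S v)) v = inner 𝕜 (S v) (S v) := hS (S v) v
  have hexp : S.reApplyInnerSelf (v + ((-K⁻¹ : ℝ) : 𝕜) • S v)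
      = S.reApplyInnerSelf v - 2 * K⁻¹ * ‖S v‖ ^ 2 + K⁻¹ ^ 2 * S.reApplyInnerSelf (S v) := by
    simp only [ContinuousLinearMap.reApplyInnerSelf_apply, map_add, map_smul, inner_add_left,
      inner_add_right, inner_smul_left, inner_smul_right, hsym, RCLike.conj_ofReal,
      RCLike.re_ofReal_mul, inner_self_eq_norm_sq]
    ring
  have hq : S.reApplyInnerSelf (S v) ≤ K * ‖S v‖ ^ 2 := by
    rw [ContinuousLinearMap.reApplyInnerSelf_apply]
    calc RCLike.re (inner 𝕜 (S (S v)) (S v)) ≤ ‖S (S v)‖ * ‖S v‖ := re_inner_le_norm _ _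
      _ ≤ (‖S‖ * ‖S v‖) * ‖S v‖ := by gcongr; exact S.le_opNorm _
      _ ≤ K * ‖S v‖ ^ 2 := by rw [mul_assoc, ← sq]; gcongr; linarith
  rw [hexp] at h
  have h2 : K⁻¹ ^ 2 * S.reApplyInnerSelf (S v) ≤ K⁻¹ ^ 2 * (K * ‖S v‖ ^ 2) := by gcongr
  have h3 : K⁻¹ ^ 2 * (K * ‖S v‖ ^ 2) = K⁻¹ * ‖S v‖ ^ 2 := by field_simp
  have h4 : K⁻¹ * ‖S v‖ ^ 2 ≤ S.reApplyInnerSelf v := by linarith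
  rwa [inv_mul_le_iff₀ hK] at h4

/-- The quadratic form of a symmetric bounded operator is bounded below by any lower bound of the
spectrum. -/
theorem mul_norm_sq_le_reApplyInnerSelf {T : H →L[𝕜] H} (hT : (T : H →ₗ[𝕜] H).IsSymmetric)
    {l : ℝ} (hl : ∀ z ∈ spectrum 𝕜 T, l ≤ RCLike.re z) (v : H) :
    l * ‖v‖ ^ 2 ≤ T.reApplyInnerSelf v := by
  by_contra! hv
  have hv0 : v ≠ 0 := by rintro rfl; simp [ContinuousLinearMap.reApplyInnerSelf_apply] at hv
  let A : Set ℝ := T.reApplyInnerSelf '' {w | ‖w‖ = 1}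
  have hbdd : BddBelow A := by
    refine ⟨-‖T‖, ?_⟩
    rintro _ ⟨w, hw, rfl⟩
    have h1 : |RCLike.re (inner 𝕜 (T w) w)| ≤ ‖T w‖ * ‖w‖ :=
      (RCLike.abs_re_le_norm _).trans (norm_inner_le_norm _ _)
    have h2 := T.le_opNorm w
    have hw' : ‖w‖ = 1 := hw
    rw [hw', mul_one] at h1 h2
    exact (neg_le_neg h2).trans (neg_le_of_abs_le h1)
  have hscale : ∀ w ≠ 0, T.reApplyInnerSelf w / ‖w‖ ^ 2 ∈ A := by
    intro w hw
    refine ⟨((‖w‖⁻¹ : ℝ) : 𝕜) • w, ?_, ?_⟩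
    · simp [norm_smul, hw]
    · rw [ContinuousLinearMap.reApplyInnerSelf_smul]
      simp [div_eq_inv_mul]
  set m := sInf A with hm
  have hml : m < l := by
    refine (csInf_le hbdd (hscale v hv0)).trans_lt ?_
    rwa [div_lt_iff₀ (by positivity)]
  -- The infimum m of the form on the unit sphere is below `l`, so it is not in the spectrum and T -
  -- m is boundedly invertible.
  have hunit : IsUnit (algebraMap 𝕜 (H →L[𝕜] H) (m : 𝕜) - T) := by
    by_contra hn
    have := hl (m : 𝕜) hn
    rw [RCLike.ofReal_re] at this
    linarith
  obtain ⟨u, hu⟩ := hunit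
  set S : H →L[𝕜] H := T - algebraMap 𝕜 (H →L[𝕜] H) (m : 𝕜) with hS
  have hSa : ∀ w, S w = T w - (m : 𝕜) • w := fun w => by
    simp [hS, Algebra.algebraMap_eq_smul_one]
  have hSr : ∀ w, S.reApplyInnerSelf w = T.reApplyInnerSelf w - m * ‖w‖ ^ 2 := fun w => by
    simp only [ContinuousLinearMap.reApplyInnerSelf_apply, hSa, inner_sub_left, inner_smul_left,
      RCLike.conj_ofReal, map_sub, RCLike.re_ofReal_mul, inner_self_eq_norm_sq]
  have hsym : (S : H →ₗ[𝕜] H).IsSymmetric := fun x y => by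
    have := hT x y
    simp only [ContinuousLinearMap.coe_coe] at *
    rw [hSa, hSa, inner_sub_left, inner_sub_right, inner_smul_left, inner_smul_right, this,
      RCLike.conj_ofReal]
  have hpos : ∀ w, 0 ≤ S.reApplyInnerSelf w := fun w => by
    rw [hSr]
    rcases eq_or_ne w 0 with rfl | hw
    · simp [ContinuousLinearMap.reApplyInnerSelf_apply]
    · have := csInf_le hbdd (hscale w hw)
      rw [le_div_iff₀ (by positivity)] at this
      linarith
  set R : H →L[𝕜] H := ((u⁻¹ : (H →L[𝕜] H)ˣ) : H →L[𝕜] H) with hR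
  have hinv : ∀ w, ‖w‖ ≤ ‖R‖ * ‖S w‖ := fun w => by
    have h1 : R (S w) = - w := by
      have h2 : R * (algebraMap 𝕜 (H →L[𝕜] H) (m : 𝕜) - T) = 1 := by rw [← hu]; exact u.inv_mul
      have h3 : S = -(algebraMap 𝕜 (H →L[𝕜] H) (m : 𝕜) - T) := by rw [hS, neg_sub]
      have h4 := congrArg (fun F : H →L[𝕜] H => F w) h2
      rw [h3, _root_.neg_apply, map_neg]
      exact congrArg Neg.neg h4
    calc ‖w‖ = ‖R (S w)‖ := by rw [h1, norm_neg]
      _ ≤ _ := R.le_opNorm _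
  -- Invertibility and the previous lemma force the form of T - m to satisfy 1 ≤ C⟨Sw, w⟩ on unit
  -- vectors, whereas m being the infimum gives a unit `w` with value below 1/(C + 1).
  set C := ‖R‖ ^ 2 * (‖S‖ + 1) with hC
  have hC0 : 0 ≤ C := by positivity
  have hε : (0 : ℝ) < 1 / (C + 1) := by positivity
  obtain ⟨_, ⟨w, hw, rfl⟩, hwlt⟩ := exists_lt_of_csInf_lt ⟨_, hscale v hv0⟩
    (show sInf A < m + 1 / (C + 1) by linarith)
  have hw' : ‖w‖ = 1 := hw
  have h1 : S.reApplyInnerSelf w < 1 / (C + 1) := by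
    rw [hSr, hw']
    linarith
  have h2 := norm_sq_le_mul_reApplyInnerSelf hsym hpos w
  have h3 : (1 : ℝ) ≤ C * S.reApplyInnerSelf w := by
    have h4 := pow_le_pow_left₀ (norm_nonneg _) (hinv w) 2
    rw [hw', one_pow, mul_pow] at h4
    calc (1 : ℝ) ≤ ‖R‖ ^ 2 * ‖S w‖ ^ 2 := h4
      _ ≤ ‖R‖ ^ 2 * ((‖S‖ + 1) * S.reApplyInnerSelf w) := by gcongr
      _ = _ := by rw [hC, mul_assoc]
  have h5 : C * S.reApplyInnerSelf w ≤ C * (1 / (C + 1)) := by gcongr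
  have h6 : C * (1 / (C + 1)) < 1 := by
    rw [mul_one_div, div_lt_one (by positivity)]
    linarith
  linarith

end Spectrum

/-! ### Symmetry and quadratic form of the nonlocal operator -/

section QuadraticForm

variable {n : ℕ} {𝕜 : Type*} [RCLike 𝕜] {J a : EuclideanSpace ℝ (Fin n) → ℝ}

theorem integrable_kernel_mul_inner (hJ : KernelH J) (μ : Measure (EuclideanSpace ℝ (Fin n)))
    [IsFiniteMeasure μ] (u v : Lp 𝕜 2 μ) :
    Integrable (fun z : EuclideanSpace ℝ (Fin n) × EuclideanSpace ℝ (Fin n) =>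
      (J (z.1 - z.2) : 𝕜) * inner 𝕜 (u z.2) (v z.1)) (μ.prod μ) := by
  have hu : Integrable u μ := (Lp.memLp u).integrable (by norm_num)
  have hv : Integrable v μ := (Lp.memLp v).integrable (by norm_num)
  have hu' : Integrable (fun x => (starRingEnd 𝕜) (u x)) μ :=
    RCLike.conjCLE.integrable_comp_iff.2 hu
  have h := hv.mul_prod hu'
  refine Integrable.bdd_mul (c := J 0)
    (f := fun z : EuclideanSpace ℝ (Fin n) × EuclideanSpace ℝ (Fin n) => (J (z.1 - z.2) : 𝕜)) (by
    simpa only [RCLike.inner_apply] using h) ?_ ?_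
  · exact (RCLike.continuous_ofReal.comp
      (hJ.continuous.comp (continuous_fst.sub continuous_snd))).aestronglyMeasurable
  · refine Filter.Eventually.of_forall fun z => ?_
    rw [RCLike.norm_ofReal, abs_of_nonneg (hJ.nonneg _)]
    exact hJ.decreasing _ _ (by simp)

theorem inner_kernelOp (hJ : KernelH J) (μ : Measure (EuclideanSpace ℝ (Fin n)))
    [IsFiniteMeasure μ] (u v : Lp 𝕜 2 μ) :
    inner 𝕜 (kernelOp 𝕜 μ hJ u) v
      = ∫ z, (J (z.1 - z.2) : 𝕜) * inner 𝕜 (u z.2) (v z.1) ∂(μ.prod μ) := by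
  rw [L2.inner_def, integral_prod _ (integrable_kernel_mul_inner hJ μ u v)]
  refine integral_congr_ae ?_
  filter_upwards [kernelOp_apply_ae μ hJ u] with x hx
  rw [hx, ← inner_conj_symm, ← integral_inner (hJ.integrable_smul μ u x), ← integral_conj]
  refine integral_congr_ae (Filter.Eventually.of_forall fun y => ?_)
  simp only [RCLike.inner_apply, map_mul, RCLike.real_smul_eq_coe_mul, RCLike.conj_conj,
    RCLike.conj_ofReal]
  ring

/-- The kernel is real and even, J being radial; swapping the two variables in the double integral
exchanges the roles of `u` and `v`. -/
theorem isSymmetric_kernelOp (hJ : KernelH J) (μ : Measure (EuclideanSpace ℝ (Fin n)))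
    [IsFiniteMeasure μ] :
    ((kernelOp 𝕜 μ hJ : Lp 𝕜 2 μ →L[𝕜] Lp 𝕜 2 μ) : Lp 𝕜 2 μ →ₗ[𝕜] Lp 𝕜 2 μ).IsSymmetric := by
  intro u v
  change inner 𝕜 (kernelOp 𝕜 μ hJ u) v = inner 𝕜 u (kernelOp 𝕜 μ hJ v)
  rw [← inner_conj_symm u, inner_kernelOp, inner_kernelOp, ← integral_conj]
  rw [← integral_prod_swap]
  refine integral_congr_ae (Filter.Eventually.of_forall fun z => ?_)
  simp only [Prod.fst_swap, Prod.snd_swap, map_mul, RCLike.conj_ofReal, inner_conj_symm]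
  rw [hJ.radial (z.2 - z.1) (z.1 - z.2) (norm_sub_rev _ _)]

theorem inner_mulOp (μ : Measure (EuclideanSpace ℝ (Fin n))) (ha : MemLp a ∞ μ)
    (u v : Lp 𝕜 2 μ) :
    inner 𝕜 (mulOp 𝕜 μ ha u) v = ∫ x, (a x : 𝕜) * inner 𝕜 (u x) (v x) ∂μ := by
  rw [L2.inner_def]
  refine integral_congr_ae ?_
  filter_upwards [mulOp_apply_ae μ ha u] with x hx
  rw [hx]
  simp only [RCLike.inner_apply, map_mul, RCLike.real_smul_eq_coe_mul, RCLike.conj_ofReal]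
  ring

theorem isSymmetric_mulOp (μ : Measure (EuclideanSpace ℝ (Fin n))) (ha : MemLp a ∞ μ) :
    ((mulOp 𝕜 μ ha : Lp 𝕜 2 μ →L[𝕜] Lp 𝕜 2 μ) : Lp 𝕜 2 μ →ₗ[𝕜] Lp 𝕜 2 μ).IsSymmetric := by
  intro u v
  change inner 𝕜 (mulOp 𝕜 μ ha u) v = inner 𝕜 u (mulOp 𝕜 μ ha v)
  rw [← inner_conj_symm u, inner_mulOp, inner_mulOp, ← integral_conj]
  refine integral_congr_ae (Filter.Eventually.of_forall fun z => ?_)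
  simp only [map_mul, RCLike.conj_ofReal, inner_conj_symm]

variable {D : Set (EuclideanSpace ℝ (Fin n))}

theorem isSymmetric_nonlocalOp (hJ : KernelH J) (hD : volume D ≠ ∞)
    (ha : MemLp a ∞ (volume.restrict D)) :
    (nonlocalOp 𝕜 hJ hD ha : Lp 𝕜 2 (volume.restrict D) →ₗ[𝕜]
      Lp 𝕜 2 (volume.restrict D)).IsSymmetric := by
  have : IsFiniteMeasure (volume.restrict D) := isFiniteMeasure_restrict.2 hD
  exact (isSymmetric_mulOp _ ha).sub (isSymmetric_kernelOp hJ _)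

theorem reApplyInnerSelf_nonlocalOp (hJ : KernelH J) (hD : volume D ≠ ∞)
    (ha : MemLp a ∞ (volume.restrict D)) (u : Lp 𝕜 2 (volume.restrict D)) :
    (nonlocalOp 𝕜 hJ hD ha).reApplyInnerSelf u = (∫ x in D, a x * ‖u x‖ ^ 2)
      - RCLike.re (∫ z, (J (z.1 - z.2) : 𝕜) * inner 𝕜 (u z.2) (u z.1)
        ∂((volume.restrict D).prod (volume.restrict D))) := by
  have : IsFiniteMeasure (volume.restrict D) := isFiniteMeasure_restrict.2 hD
  rw [ContinuousLinearMap.reApplyInnerSelf_apply]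
  change RCLike.re (inner 𝕜 (mulOp 𝕜 (volume.restrict D) ha u
    - kernelOp 𝕜 (volume.restrict D) hJ u) u) = _
  rw [inner_sub_left, map_sub, inner_mulOp, inner_kernelOp]
  congr 1
  have : ∀ x, (a x : 𝕜) * inner 𝕜 (u x) (u x) = ((a x * ‖u x‖ ^ 2 : ℝ) : 𝕜) := fun x => by
    rw [inner_self_eq_norm_sq_to_K]
    push_cast
    rfl
  simp only [this]
  rw [integral_ofReal, RCLike.ofReal_re]

/-- The quadratic form on the class of a real-valued function. -/
theorem reApplyInnerSelf_nonlocalOp_of_ae_eq (hJ : KernelH J) (hD : volume D ≠ ∞)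
    (ha : MemLp a ∞ (volume.restrict D)) {u : Lp 𝕜 2 (volume.restrict D)}
    {w : EuclideanSpace ℝ (Fin n) → ℝ} (hw : u =ᵐ[volume.restrict D] fun x => (w x : 𝕜)) :
    (nonlocalOp 𝕜 hJ hD ha).reApplyInnerSelf u = (∫ x in D, a x * w x ^ 2)
      - ∫ z, rieszKernel J w z ∂((volume.restrict D).prod (volume.restrict D)) := by
  have : IsFiniteMeasure (volume.restrict D) := isFiniteMeasure_restrict.2 hD
  rw [reApplyInnerSelf_nonlocalOp]
  congr 1
  · refine integral_congr_ae ?_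
    filter_upwards [hw] with x hx
    rw [hx, RCLike.norm_ofReal, sq_abs]
  · have h1 := Measure.quasiMeasurePreserving_fst (μ := volume.restrict D)
      (ν := volume.restrict D) |>.ae hw
    have h2 := Measure.quasiMeasurePreserving_snd (μ := volume.restrict D)
      (ν := volume.restrict D) |>.ae hw
    rw [← RCLike.ofReal_re (K := 𝕜) (∫ z, rieszKernel J w z ∂_), ← integral_ofReal]
    congr 1
    refine integral_congr_ae ?_
    filter_upwards [h1, h2] with z hz1 hz2
    rw [hz1, hz2, rieszKernel]
    simp only [RCLike.inner_apply, RCLike.conj_ofReal]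
    push_cast
    rfl

/-- Replacing a function by its modulus does not increase the quadratic form. -/
theorem le_reApplyInnerSelf_nonlocalOp (hJ : KernelH J) (hD : volume D ≠ ∞)
    (ha : MemLp a ∞ (volume.restrict D)) (u : Lp 𝕜 2 (volume.restrict D)) :
    (∫ x in D, a x * ‖u x‖ ^ 2)
      - ∫ z, rieszKernel J (fun x => ‖u x‖) z ∂((volume.restrict D).prod (volume.restrict D))
      ≤ (nonlocalOp 𝕜 hJ hD ha).reApplyInnerSelf u := by
  have : IsFiniteMeasure (volume.restrict D) := isFiniteMeasure_restrict.2 hD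
  rw [reApplyInnerSelf_nonlocalOp]
  refine sub_le_sub_left ((RCLike.re_le_norm _).trans ((norm_integral_le_integral_norm _).trans_eq
    (integral_congr_ae (Filter.Eventually.of_forall fun z => ?_)))) _
  simp only [rieszKernel, RCLike.inner_apply, norm_mul, RCLike.norm_ofReal, RCLike.norm_conj,
    abs_of_nonneg (hJ.nonneg _)]

theorem norm_sq_eq_integral_of_ae_eq {α : Type*} [MeasurableSpace α] {μ : Measure α}
    {u : Lp 𝕜 2 μ} {w : α → ℝ} (hw : ∀ᵐ x ∂μ, ‖u x‖ = |w x|) :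
    ‖u‖ ^ 2 = ∫ x, w x ^ 2 ∂μ := by
  rw [← inner_self_eq_norm_sq (𝕜 := 𝕜), L2.inner_def,
    ← RCLike.ofReal_re (K := 𝕜) (∫ x, w x ^ 2 ∂μ), ← integral_ofReal]
  congr 1
  refine integral_congr_ae ?_
  filter_upwards [hw] with x hx
  rw [inner_self_eq_norm_sq_to_K, hx, ← sq_abs (w x)]
  push_cast
  rfl

/-- Links the form on L²(D) to the whole-space energy used for rearrangement. Vanishing almost
everywhere off `D` is all that is known of the rearranged function. -/
theorem integral_rieszKernel_restrict {E : Type*} [NormedAddCommGroup E] [MeasureSpace E]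
    [SFinite (volume : Measure E)] {J w : E → ℝ} {D : Set E}
    (hw : ∀ᵐ x, x ∉ D → w x = 0) :
    ∫ z, rieszKernel J w z ∂((volume.restrict D).prod (volume.restrict D))
      = ∫ z, rieszKernel J w z ∂((volume : Measure E).prod volume) := by
  rw [Measure.prod_restrict]
  refine setIntegral_eq_integral_of_ae_compl_eq_zero ?_
  filter_upwards [Measure.quasiMeasurePreserving_fst.ae hw,
    Measure.quasiMeasurePreserving_snd.ae hw] with z h1 h2 hz
  rw [mem_prod, not_and_or] at hz
  rcases hz with h | h
  · rw [rieszKernel, h1 h, zero_mul, mul_zero]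
  · rw [rieszKernel, h2 h, mul_zero, mul_zero]

end QuadraticForm

/-! ### Density and comparison of the two forms -/

section Comparison

open scoped ContDiff

variable {n : ℕ}

/-- The subspace of `L²(Ω)` of classes of smooth functions with compact support in `Ω`. -/
def testFunctions (Ω : Set (EuclideanSpace ℝ (Fin n))) :
    Submodule ℝ (Lp ℝ 2 (volume.restrict Ω)) where
  carrier := {p | ∃ f : EuclideanSpace ℝ (Fin n) → ℝ, ContDiff ℝ ∞ f ∧ HasCompactSupport f ∧
    tsupport f ⊆ Ω ∧ p =ᵐ[volume.restrict Ω] f}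
  add_mem' := by
    rintro p q ⟨f, hf, hfc, hfs, hpf⟩ ⟨g, hg, hgc, hgs, hqg⟩
    exact ⟨f + g, hf.add hg, hfc.add hgc, (tsupport_add f g).trans (union_subset hfs hgs),
      (Lp.coeFn_add p q).trans (hpf.add hqg)⟩
  zero_mem' := ⟨0, contDiff_const, HasCompactSupport.zero, by simp, Lp.coeFn_zero _ _ _⟩
  smul_mem' := by
    rintro c p ⟨f, hf, hfc, hfs, hpf⟩
    refine ⟨c • f, hf.const_smul c, hfc.mono (Function.support_const_smul_subset c f),
      (closure_mono (Function.support_const_smul_subset c f)).trans hfs,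
      (Lp.coeFn_smul c p).trans ?_⟩
    filter_upwards [hpf] with x hx
    rw [Pi.smul_apply, Pi.smul_apply, hx]

/-- An element orthogonal to all test functions is zero by the fundamental lemma of the calculus of
variations. -/
theorem topologicalClosure_testFunctions {Ω : Set (EuclideanSpace ℝ (Fin n))} (hΩo : IsOpen Ω)
    (hΩ : volume Ω ≠ ⊤) : (testFunctions Ω).topologicalClosure = ⊤ := by
  have : IsFiniteMeasure (volume.restrict Ω) := isFiniteMeasure_restrict.2 hΩ
  rw [Submodule.topologicalClosure_eq_top_iff, Submodule.eq_bot_iff]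
  intro p hp
  rw [Submodule.mem_orthogonal] at hp
  have hpi : Integrable p (volume.restrict Ω) := (Lp.memLp p).integrable (by norm_num)
  have key := hΩo.ae_eq_zero_of_integral_contDiff_smul_eq_zero (f := p) (μ := volume.restrict Ω)
    (hpi.locallyIntegrable.locallyIntegrableOn Ω) fun f hf hfc hfs => by
      have hmem : MemLp f 2 (volume.restrict Ω) :=
        (hf.continuous.memLp_of_hasCompactSupport hfc)
      have h0 := hp (hmem.toLp f) ⟨f, hf, hfc, hfs, hmem.coeFn_toLp⟩
      rw [L2.inner_def] at h0
      rw [← h0]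
      refine integral_congr_ae ?_
      filter_upwards [hmem.coeFn_toLp] with x hx
      rw [hx, smul_eq_mul, RCLike.inner_apply, mul_comm]
      rfl
  refine Lp.ext ?_
  filter_upwards [key, ae_restrict_mem hΩo.measurableSet, Lp.coeFn_zero ℝ 2 (volume.restrict Ω)]
    with x h1 h2 h3
  rw [h1 h2, h3, Pi.zero_apply]

/-- The modulus destroys smoothness but not the Lipschitz bound, which is why rearrangement is
carried out in a Lipschitz class. -/
theorem exists_lipClass_abs {E : Type*} [NormedAddCommGroup E] [InnerProductSpace ℝ E]
    {f : E → ℝ} (hf : ContDiff ℝ ∞ f) (hfc : HasCompactSupport f) :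
    ∃ L M R : ℝ, 0 ≤ L ∧ LipClass L M R fun x => |f x| := by
  obtain ⟨C, hC⟩ := ContDiff.lipschitzWith_of_hasCompactSupport hfc hf (by simp)
  obtain ⟨M, hM⟩ := hfc.exists_bound_of_continuous hf.continuous
  obtain ⟨R, hR⟩ := hfc.isCompact.isBounded.subset_closedBall 0
  refine ⟨C, M, R, C.2, fun x y => ?_, fun x => abs_nonneg _, hM, fun x hx => ?_⟩
  · refine (abs_abs_sub_abs_le_abs_sub _ _).trans ?_
    have := hC.dist_le_mul x y
    rwa [Real.dist_eq, dist_eq_norm] at this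
  · have : f x = 0 := image_eq_zero_of_notMem_tsupport fun h =>
      hx.not_ge (by simpa using hR h)
    simp only [this, abs_zero]

variable {𝕜 : Type*} [RCLike 𝕜] {J a : EuclideanSpace ℝ (Fin n) → ℝ}
  {Ω : Set (EuclideanSpace ℝ (Fin n))}

/-- A lower bound of the spectrum of `B*` bounds the quadratic form of `B` on Lipschitz
functions. -/
theorem LipClass.mul_integral_sq_le (hn : 0 < n) (hJ : KernelH J) (hΩo : IsOpen Ω)
    (hΩb : Bornology.IsBounded Ω) (ha : ContinuousOn a (closure Ω))
    (ha0 : ∀ x ∈ closure Ω, 0 ≤ a x) {l : ℝ}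
    (hl : ∀ z ∈ spectrum 𝕜 (opBStar 𝕜 hJ hΩb ha), l ≤ RCLike.re z)
    {L M R : ℝ} (hL : 0 ≤ L) {f : EuclideanSpace ℝ (Fin n) → ℝ} (hf : LipClass L M R f)
    (hfΩ : ∀ x ∉ Ω, f x = 0) :
    l * ∫ x in Ω, f x ^ 2 ≤ (∫ x in Ω, a x * f x ^ 2)
      - ∫ z, rieszKernel J f z ∂((volume.restrict Ω).prod (volume.restrict Ω)) := by
  have hΩ : volume Ω ≠ ⊤ := hΩb.measure_lt_top.ne
  obtain ⟨g, hg, hgr, hgv, hQ⟩ :=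
    hf.exists_radial_rearrangement hJ.continuous hJ.nonneg hJ.decreasing hL
  have hgz := ae_eq_zero_of_notMem_symmBall hn hΩ hfΩ hg.nonneg hgr hgv
  have hHL := setIntegral_symmIncRearr_mul_sq_le hn hΩo hΩb ha ha0 hf.continuous
    hf.hasCompactSupport hf.nonneg hfΩ hg.continuous.measurable hg.nonneg hgr hgv
  have hmem : MemLp (fun x => (g x : 𝕜)) 2 (volume.restrict (symmBall Ω)) :=
    ((hg.continuous.memLp_of_hasCompactSupport (μ := volume) hg.hasCompactSupport).restrict _).ofReal
  -- The spectral bound for B* is tested on the rearranged function.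
  have hT := mul_norm_sq_le_reApplyInnerSelf (T := opBStar 𝕜 hJ hΩb ha)
    (isSymmetric_nonlocalOp hJ measure_ball_lt_top.ne (memLp_top_symmIncRearr hΩb ha _)) hl
    (hmem.toLp _)
  have hnorm := norm_sq_eq_integral_of_ae_eq (u := hmem.toLp _) (w := g) (by
    filter_upwards [hmem.coeFn_toLp] with x hx
    rw [hx, RCLike.norm_ofReal])
  have hform : (opBStar 𝕜 hJ hΩb ha).reApplyInnerSelf (hmem.toLp _) = _ :=
    reApplyInnerSelf_nonlocalOp_of_ae_eq hJ (D := symmBall Ω) measure_ball_lt_top.ne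
      (memLp_top_symmIncRearr hΩb ha _) hmem.coeFn_toLp
  rw [hform, hnorm, integral_rieszKernel_restrict hgz,
    setIntegral_eq_integral_of_ae_compl_eq_zero (by
      filter_upwards [hgz] with x hx h
      rw [hx h, zero_pow two_ne_zero]),
    integral_sq_eq_of_equimeasurable hf.continuous.measurable hg.continuous.measurable hf.nonneg
      hg.nonneg hgv] at hT
  rw [setIntegral_eq_integral_of_forall_compl_eq_zero (fun x hx => by
      rw [hfΩ x hx, zero_pow two_ne_zero]),
    integral_rieszKernel_restrict (Filter.Eventually.of_forall hfΩ)]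
  linarith

/-- A lower bound of the spectrum of `B*` bounds the quadratic form of `B` on nonnegative
functions. -/
theorem mul_norm_sq_le_reApplyInnerSelf_abs (hn : 0 < n) (hJ : KernelH J) (hΩo : IsOpen Ω)
    (hΩb : Bornology.IsBounded Ω) (ha : ContinuousOn a (closure Ω))
    (ha0 : ∀ x ∈ closure Ω, 0 ≤ a x) {l : ℝ}
    (hl : ∀ z ∈ spectrum 𝕜 (opBStar 𝕜 hJ hΩb ha), l ≤ RCLike.re z)
    (p : Lp ℝ 2 (volume.restrict Ω)) :
    l * ‖p‖ ^ 2 ≤ (opB ℝ hJ hΩo hΩb ha).reApplyInnerSelf |p| := by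
  have hΩ : volume Ω ≠ ⊤ := hΩb.measure_lt_top.ne
  have habs : Continuous fun p : Lp ℝ 2 (volume.restrict Ω) => |p| :=
    (LipschitzWith.of_dist_le_mul (K := 1) fun p q => by
      rw [dist_eq_norm, dist_eq_norm, NNReal.coe_one, one_mul]
      exact norm_abs_sub_abs p q).continuous
  -- Taking |p| inside the form lets `p` run over the linear space of test functions, so no density
  -- of nonnegative functions is needed.
  have hclosed : IsClosed {p : Lp ℝ 2 (volume.restrict Ω) |
      l * ‖p‖ ^ 2 ≤ (opB ℝ hJ hΩo hΩb ha).reApplyInnerSelf |p|} :=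
    isClosed_le (by fun_prop)
      ((opB ℝ hJ hΩo hΩb ha).reApplyInnerSelf_continuous.comp habs)
  have hmem : p ∈ closure (testFunctions Ω : Set (Lp ℝ 2 (volume.restrict Ω))) := by
    rw [← Submodule.topologicalClosure_coe, topologicalClosure_testFunctions hΩo hΩ]
    trivial
  refine closure_minimal ?_ hclosed hmem
  rintro q ⟨f, hf, hfc, hfs, hqf⟩
  obtain ⟨L, M, R, hL, hlip⟩ := exists_lipClass_abs hf hfc
  have hfΩ : ∀ x ∉ Ω, |f x| = 0 := fun x hx => by
    have : f x = 0 := image_eq_zero_of_notMem_tsupport fun h => hx (hfs h)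
    rw [this, abs_zero]
  have h := hlip.mul_integral_sq_le hn hJ hΩo hΩb ha ha0 hl hL hfΩ
  have hq : (|q| : Lp ℝ 2 (volume.restrict Ω)) =ᵐ[volume.restrict Ω]
      fun x => ((|f x| : ℝ) : ℝ) := by
    filter_upwards [Lp.coeFn_abs q, hqf] with x h1 h2
    rw [h1, h2]
  have hform := reApplyInnerSelf_nonlocalOp_of_ae_eq hJ hΩ
    (memLp_top_of_continuousOn hΩo hΩb ha) hq
  have hnorm := norm_sq_eq_integral_of_ae_eq (u := q) (w := fun x => |f x|) (by
    filter_upwards [hqf] with x h1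
    rw [h1, Real.norm_eq_abs, abs_abs])
  change l * ‖q‖ ^ 2 ≤ (opB ℝ hJ hΩo hΩb ha).reApplyInnerSelf |q|
  rw [opB, hform, hnorm]
  exact h

end Comparison

end

/-! ### Comparison of the first eigenvalues -/

theorem mainTheorem2 {𝕜 : Type*} [RCLike 𝕜] {n : ℕ} (hn : 0 < n)
    (J : EuclideanSpace ℝ (Fin n) → ℝ) (hJ : KernelH J)
    (Ω : Set (EuclideanSpace ℝ (Fin n))) (hΩo : IsOpen Ω) (hΩb : Bornology.IsBounded Ω)
    (a : EuclideanSpace ℝ (Fin n) → ℝ) (hac : ContinuousOn a (closure Ω))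
    (ha0 : ∀ x ∈ closure Ω, 0 ≤ a x)
    (lam lamStar : ℝ)
    (hlam : IsFirstEigenvalue (opB 𝕜 hJ hΩo hΩb hac) lam)
    (hlamStar : IsFirstEigenvalue (opBStar 𝕜 hJ hΩb hac) lamStar) :
    lamStar ≤ lam := by
  obtain ⟨u, hu⟩ := hlam.1.exists_hasEigenvector
  have hu0 : 0 < ‖u‖ := norm_pos_iff.2 hu.2
  have hTu : opB 𝕜 hJ hΩo hΩb hac u = (lam : 𝕜) • u := hu.apply_eq_smul
  have hΩ : volume Ω ≠ ∞ := hΩb.measure_lt_top.ne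
  have hval : (opB 𝕜 hJ hΩo hΩb hac).reApplyInnerSelf u = lam * ‖u‖ ^ 2 := by
    rw [ContinuousLinearMap.reApplyInnerSelf_apply, hTu, inner_smul_left, RCLike.conj_ofReal,
      RCLike.re_ofReal_mul, inner_self_eq_norm_sq]
  have hmod := le_reApplyInnerSelf_nonlocalOp hJ hΩ (memLp_top_of_continuousOn hΩo hΩb hac) u
  have hmem : MemLp (fun x => ‖u x‖) 2 (volume.restrict Ω) := (Lp.memLp u).norm
  -- The modulus of the 𝕜-valued eigenvector is a real class of equal norm; this carries the
  -- argument from 𝕜 to ℝ.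
  set p : Lp ℝ 2 (volume.restrict Ω) := hmem.toLp _ with hp
  have habs : (|p| : Lp ℝ 2 (volume.restrict Ω)) =ᵐ[volume.restrict Ω]
      fun x => ((‖u x‖ : ℝ) : ℝ) := by
    filter_upwards [Lp.coeFn_abs p, hmem.coeFn_toLp] with x h1 h2
    rw [h1, h2, abs_norm]
  have hform := reApplyInnerSelf_nonlocalOp_of_ae_eq hJ hΩ
    (memLp_top_of_continuousOn hΩo hΩb hac) habs
  have hnorm : ‖p‖ = ‖u‖ := by
    rw [hp, Lp.norm_toLp, Lp.norm_def, eLpNorm_norm]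
  have h := mul_norm_sq_le_reApplyInnerSelf_abs hn hJ hΩo hΩb hac ha0 hlamStar.2 p
  rw [opB, hform, hnorm] at h
  rw [opB] at hval
  rw [hval] at hmod
  -- `lamStar * ‖u‖ ^ 2` is at most the form at |u|, which is at most `lam * ‖u‖ ^ 2`.
  exact le_of_mul_le_mul_right (h.trans hmod) (by positivity)
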